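/- **Risk model.** Let $d\ge 1$. Let $\mathbf X^{(1)},\mathbf X^{(2)},\dots$ be i.i.d. $\mathbb R^d$-valued random vectors (claims) with law $F$ and finite mean, and let $Y_1,Y_2,\dots$ be i.i.d. almost surely positive random variables (interarrival times), independent of the sequence of claims. Put $T_n=Y_1+\dots+Y_n$ and $N_t=\sup\{n\ge 1: T_n\le t\}$ (with $\sup\emptyset=0$). Let $\mathbf p\in[0,\infty)^d$ be the vector of premium rates and let $\mathbf b\in(0,\infty)^d$ satisfy $b_1+\dots+b_d=1$. For initial capital $u>0$ the risk reserve is $$\mathbf R_t=u\mathbf b+t\mathbf p-\sum_{i=1}^{N_t}\mathbf X^{(i)},\qquad t\ge 0 .$$ Assume that $\mathbf Z=\mathbf X^{(1)}-Y_1\mathbf p$ has finite mean and that the safety loading is positive: all coordinates of $\mathbf c=-\mathbb E[\mathbf Z]$ are strictly positive. **Ruin set.** Let $L\subset\mathbb R^d$ be open and decreasing, with $\mathbf 0\in\partial L$, $uL=L$ for all $u>0$, and $L^c$ convex. Put $A=\mathbf b-L$ and $$\psi_{\mathbf b,L}(u)=P(\mathbf R_t\in L\text{ for some }t\ge 0),\qquad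 H(u)=\int_0^\infty F(uA+v\mathbf c)\,dv,\qquad u>0 .$$ **Integrated tail law and the class $\mathscr S_A$.** Let $F^I$ be the probability measure on $\mathbb R^d$, concentrated on $E=\mathbb R^d\setminus(-\infty,0]^d$, given by $$F^I(B)=\frac1\theta\int_0^\infty F\bigl((B\cap E)+v\mathbf c\bigr)\,dv,\qquad \theta=\int_0^\infty F(E+v\mathbf c)\,dv<\infty ,$$ where it is assumed that $\theta>0$. In particular $F^I(uA)=H(u)/\theta$ for $u>0$. A probability measure $G$ on $\mathbb R^d$ belongs to $\mathscr S_A$ if the distribution function $t\mapsto 1-G(tA)$, $t>0$, on $[0,\infty)$ is subexponential, that is, if independent random variables $\xi_1,\xi_2\ge 0$ with this distribution function satisfy $P(\xi_1>x)>0$ for all $x$ and $P(\xi_1+\xi_2>x)/P(\xi_1>x)\to 2$ as $x\to\infty$. **Theorem.** If $F^I\in\mathscr S_A$, then $$\lim_{u\to\infty}\frac{\psi_{\mathbf b,L}(u)}{H(u)}=1 .$$ -/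

import Mathlib

open MeasureTheory ProbabilityTheory Filter Topology Set
open scoped Pointwise

namespace RuinModel

/-- The family of open increasing sets with convex complement whose closure misses the origin. -/
structure IsRiskRegion {d : ℕ} (A : Set (Fin d → ℝ)) : Prop where
  isOpen : IsOpen A
  increasing : IsUpperSet A
  convex_compl : Convex ℝ Aᶜ
  zero_notMem_closure : (0 : Fin d → ℝ) ∉ closure A

/-- Admissible ruin sets: open decreasing cones with convex complement and with the origin on
the boundary. -/
structure IsRuinSet {d : ℕ} (L : Set (Fin d → ℝ)) : Prop where
  isOpen : IsOpen L
  decreasing : IsLowerSet L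
  zero_mem_frontier : (0 : Fin d → ℝ) ∈ frontier L
  smul_eq : ∀ u : ℝ, 0 < u → u • L = L
  convex_compl : Convex ℝ Lᶜ

/-- The set `A = b - L`. -/
def surplusSet {d : ℕ} (b : Fin d → ℝ) (L : Set (Fin d → ℝ)) : Set (Fin d → ℝ) :=
  (fun x => b - x) '' L

theorem mem_surplusSet {d : ℕ} {b : Fin d → ℝ} {L : Set (Fin d → ℝ)} {x : Fin d → ℝ} :
    x ∈ surplusSet b L ↔ b - x ∈ L := by
  constructor
  · rintro ⟨y, hy, rfl⟩
    simpa using hy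
  · intro h
    exact ⟨b - x, h, by simp⟩

/-- The set `b - L` belongs to the family of sets for which subexponentiality is defined. -/
theorem IsRuinSet.isRiskRegion {d : ℕ} {b : Fin d → ℝ} {L : Set (Fin d → ℝ)}
    (hL : IsRuinSet L) (hb : ∀ j, 0 < b j) : IsRiskRegion (surplusSet b L) := by
  have hpre : surplusSet b L = (fun x => b - x) ⁻¹' L := by
    ext x
    exact mem_surplusSet
  have h0 : (0 : Fin d → ℝ) ∉ L := by
    have h := hL.zero_mem_frontier
    rw [hL.isOpen.frontier_eq] at h
    exact h.2
  have hcont : Continuous (fun x : Fin d → ℝ => b - x) := by fun_prop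
  refine ⟨?_, ?_, ?_, ?_⟩
  · rw [hpre]
    exact hL.isOpen.preimage hcont
  · intro x y hxy hx
    rw [mem_surplusSet] at hx ⊢
    exact hL.decreasing (sub_le_sub_left hxy b) hx
  · intro x hx y hy s t hs ht hst
    rw [mem_compl_iff, mem_surplusSet] at hx hy ⊢
    have h := hL.convex_compl hx hy hs ht hst
    have e : s • (b - x) + t • (b - y) = b - (s • x + t • y) := by
      have : b = s • b + t • b := by rw [← add_smul, hst, one_smul]
      conv_rhs => rw [this]
      simp only [smul_sub]
      abel
    rwa [e] at h
  · intro h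
    have hU : IsOpen {x : Fin d → ℝ | ∀ j, x j < b j} := by
      simp only [ofPred_forall]
      exact isOpen_iInter_of_finite fun j => isOpen_lt (continuous_apply j) continuous_const
    obtain ⟨x, hx, hxA⟩ := mem_closure_iff.1 h _ hU (by simpa using hb)
    rw [mem_surplusSet] at hxA
    exact h0 (hL.decreasing (fun j => by simpa using (hx j).le) hxA)

/-- A law on `[0, ∞)` is subexponential when `P (X₁ + X₂ > x) / P (X₁ > x) → 2` for independent
`X₁`, `X₂` with this law. This forces `P (X₁ > x) > 0` for every `x`, as the quotient would
otherwise be `0` for all large `x`. -/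
structure IsSubexponential (ν : Measure ℝ) : Prop where
  isProbabilityMeasure : IsProbabilityMeasure ν
  nonneg : ν (Iio 0) = 0
  tendsto_ratio :
    Tendsto (fun x : ℝ => (Measure.conv ν ν).real (Ioi x) / ν.real (Ioi x)) atTop (𝓝 2)

/-- The class `S_A`: the distribution function `t ↦ 1 - F (t A)` on `[0, ∞)` is the distribution
function of a subexponential law. (The value at `t = 0` is fixed by right continuity.) -/
def MemSubexpClass {d : ℕ} (A : Set (Fin d → ℝ)) (F : Measure (Fin d → ℝ)) : Prop :=
  ∃ ν : Measure ℝ, IsSubexponential ν ∧ ∀ t : ℝ, 0 < t → cdf ν t = 1 - F.real (t • A)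

/-- The measure `B ↦ ∫_0^∞ F (B + v c) dv`. -/
noncomputable def shiftMeasure {d : ℕ} (F : Measure (Fin d → ℝ)) (c : Fin d → ℝ) :
    Measure (Fin d → ℝ) :=
  (F.prod (volume.restrict (Ioi (0 : ℝ)))).map (fun z => z.1 - z.2 • c)

theorem shiftMeasure_apply {d : ℕ} (F : Measure (Fin d → ℝ)) [SFinite F] (c : Fin d → ℝ)
    {B : Set (Fin d → ℝ)} (hB : MeasurableSet B) :
    shiftMeasure F c B = ∫⁻ v in Ioi (0 : ℝ), F ((fun x => x + v • c) '' B) := by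
  have hm : Measurable (fun z : (Fin d → ℝ) × ℝ => z.1 - z.2 • c) := by fun_prop
  rw [shiftMeasure, Measure.map_apply hm hB, Measure.prod_apply_symm (hm hB)]
  congr 1
  ext v
  congr 1
  ext x
  simp only [mem_preimage, mem_image]
  constructor
  · intro h
    exact ⟨x - v • c, h, by simp⟩
  · rintro ⟨y, hy, rfl⟩
    simpa using hy

/-- The multivariate integrated tail law `F^I`: the measure `B ↦ ∫_0^∞ F (B + v c) dv`, taken on
the vectors with at least one positive coordinate and normalized there to total mass one. For
`d = 1` it is the usual integrated tail distribution on `(0, ∞)`. -/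
noncomputable def integratedTail {d : ℕ} (F : Measure (Fin d → ℝ)) (c : Fin d → ℝ) :
    Measure (Fin d → ℝ) :=
  ProbabilityTheory.cond (shiftMeasure F c) {x | ∃ j, 0 < x j}

/-- `H u = ∫_0^∞ F (u A + v c) dv`. -/
noncomputable def tailIntegral {d : ℕ} (F : Measure (Fin d → ℝ)) (c : Fin d → ℝ)
    (A : Set (Fin d → ℝ)) (u : ℝ) : ℝ :=
  ∫ v in Ioi (0 : ℝ), F.real ((fun x => x + v • c) '' (u • A))

/-- Arrival time of the `n`-th claim, `T_n = Y_1 + ⋯ + Y_n`; the sequence `Y` is indexed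
from `0`. -/
noncomputable def arrivalTime {Ω : Type*} (Y : ℕ → Ω → ℝ) (n : ℕ) (ω : Ω) : ℝ :=
  ∑ i ∈ Finset.range n, Y i ω

/-- Number of claims up to time `t`, `N_t = sup {n ≥ 1 : T_n ≤ t}`, with `sup ∅ = 0`. -/
noncomputable def claimCount {Ω : Type*} (Y : ℕ → Ω → ℝ) (t : ℝ) (ω : Ω) : ℕ :=
  sSup {n : ℕ | 1 ≤ n ∧ arrivalTime Y n ω ≤ t}

/-- Risk reserve at time `t` with initial capital `u` allocated along `b`. -/
noncomputable def riskReserve {d : ℕ} {Ω : Type*} (X : ℕ → Ω → Fin d → ℝ) (Y : ℕ → Ω → ℝ)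
    (p b : Fin d → ℝ) (u t : ℝ) (ω : Ω) : Fin d → ℝ :=
  u • b + t • p - ∑ i ∈ Finset.range (claimCount Y t ω), X i ω

/-- The ruin probability. -/
noncomputable def ruinProb {d : ℕ} {Ω : Type*} [MeasurableSpace Ω] (P : Measure Ω)
    (X : ℕ → Ω → Fin d → ℝ) (Y : ℕ → Ω → ℝ) (p b : Fin d → ℝ) (L : Set (Fin d → ℝ))
    (u : ℝ) : ℝ :=
  P.real {ω | ∃ t : ℝ, 0 ≤ t ∧ riskReserve X Y p b u t ω ∈ L}

end RuinModel

namespace RuinModel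

open scoped ENNReal

/-! Let `g` be the gauge of the closed convex set `Aᶜ`, a neighbourhood of the origin. It is
monotone and subadditive, and `u • A = {u < g}`. Ruin need only be checked at claim times, so up to
a null set it means that the walk `S_n = Z_1 + ⋯ + Z_n` satisfies `u < g (S_n)` for some `n`. The
hypothesis on `F^I` says that `H = θ · ν(u, ∞)` with `ν` subexponential. What remains is the
principle of one big jump: the probability of exceeding `u` is asymptotic to `θ · ν(u, ∞)`.

Upper bound (`eventually_measure_exceed_le`): cut the walk when it first fails to lie below the line
`ρ - n (1 - s) c`. By the law of large numbers this has probability at most a small `γ` once `ρ` is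
large. The exit is caused by a single claim, so summing over its index bounds the tail of the exit
height by `α · ν(x, ∞)`, with `α` close to `θ`. An independent copy of the walk starts afterwards,
and subadditivity of `g` yields a renewal inequality (`measure_max_le_lintegral_exitTail`).
Inserting an asymptotic bound `b · ν` into it returns `(4γb + rα) · ν` for any `r > 1`, so the best
constant is at most `α / (1 - 4γ)` (`eventually_iSup_le`). Now let `s → 0`.

Lower bound (`eventually_le_measure_exceed`): with probability near one the walk stays below level
`u` and above a line of slope `-(1 + s) c`. A claim large enough to lift it over `u` at the next
step is independent of this past. These events are disjoint in `n`, and their probabilities add up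
to nearly `H(u)`. -/

/-! ### Convolution tails and subexponential laws on the line. -/

theorem conv_Ioi (μ ν : Measure ℝ) [SFinite μ] [SFinite ν] (u : ℝ) :
    (Measure.conv μ ν) (Ioi u) = ∫⁻ x, ν (Ioi (u - x)) ∂μ := by
  have hm : Measurable fun z : ℝ × ℝ => z.1 + z.2 := by fun_prop
  rw [Measure.conv, Measure.map_apply hm measurableSet_Ioi,
    Measure.prod_apply (hm measurableSet_Ioi)]
  congr 1
  ext x
  congr 1
  ext y
  simp only [mem_preimage, mem_Ioi]
  constructor <;> intro h <;> linarith

theorem measure_Ioi_antitone (ν : Measure ℝ) : Antitone fun x => ν (Ioi x) :=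
  fun _ _ h => measure_mono (Ioi_subset_Ioi h)

theorem measurable_tail_sub (ν : Measure ℝ) (u : ℝ) : Measurable fun x => ν (Ioi (u - x)) :=
  Monotone.measurable fun _ _ h => measure_Ioi_antitone ν (by linarith)

/-- One step of the renewal inequality. -/
theorem renewal_step_le (ν : Measure ℝ) {w : ℝ → ℝ≥0∞} (hw : ∀ u, w u ≤ 1)
    {b α γ : ℝ≥0∞} {x₀ u₁ u : ℝ} (hb : ∀ y, u₁ ≤ y → w y ≤ b * ν (Ioi y)) (hu₁ : 0 ≤ u₁) (hu : x₀ + u₁ ≤ u) :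
    γ * w (u - x₀) + α * ∫⁻ x in Ioi x₀, w (u - x) ∂ν ≤
      b * (α * (∫⁻ x in Ioc x₀ u, ν (Ioi (u - x)) ∂ν) + γ * ν (Ioi (u - x₀))) +
        α * ν (Ioi (u - u₁)) := by
  have h1 : w (u - x₀) ≤ b * ν (Ioi (u - x₀)) := hb _ (by linarith)
  have h2 : ∫⁻ x in Ioi x₀, w (u - x) ∂ν ≤
      b * (∫⁻ x in Ioc x₀ u, ν (Ioi (u - x)) ∂ν) + ν (Ioi (u - u₁)) := by
    -- For `x ≤ u - u₁` the argument `u - x` is at least `u₁` and the bound by `b` applies; beyond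
    -- that only `w ≤ 1` is used.
    rw [← Ioc_union_Ioi_eq_Ioi (show x₀ ≤ u - u₁ by linarith)]
    refine (lintegral_union_le _ _ _).trans (add_le_add ?_ ?_)
    · rw [← lintegral_const_mul _ (measurable_tail_sub ν u)]
      refine (setLIntegral_mono' measurableSet_Ioc fun x hx => hb _ (by linarith [hx.2])).trans ?_
      exact lintegral_mono_set (Ioc_subset_Ioc_right (by linarith))
    · calc _ ≤ ∫⁻ x in Ioi (u - u₁), 1 ∂ν := lintegral_mono fun x => hw _
        _ = _ := by simp
  calc _ ≤ γ * (b * ν (Ioi (u - x₀))) +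
        α * (b * (∫⁻ x in Ioc x₀ u, ν (Ioi (u - x)) ∂ν) + ν (Ioi (u - u₁))) := by gcongr
    _ = _ := by ring

namespace IsSubexponential

variable {ν : Measure ℝ}

theorem tail_pos (hν : IsSubexponential ν) (x : ℝ) : 0 < ν (Ioi x) := by
  have := hν.isProbabilityMeasure
  refine pos_iff_ne_zero.2 fun h0 => ?_
  have h1 : (fun x : ℝ => (Measure.conv ν ν).real (Ioi x) / ν.real (Ioi x)) =ᶠ[atTop]
      fun _ => 0 := by
    filter_upwards [eventually_ge_atTop x] with y hy
    have : ν.real (Ioi y) = 0 := by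
      rw [measureReal_def, measure_mono_null (Ioi_subset_Ioi hy) h0, ENNReal.toReal_zero]
    rw [this, div_zero]
  have h2 := tendsto_nhds_unique (hν.tendsto_ratio.congr' h1) tendsto_const_nhds
  norm_num at h2

theorem tendsto_tail (hν : IsSubexponential ν) :
    Tendsto (fun x => ν (Ioi x)) atTop (𝓝 0) := by
  have := hν.isProbabilityMeasure
  have h1 : ∀ x, ν (Ioi x) = ENNReal.ofReal (1 - cdf ν x) := fun x => by
    rw [cdf_eq_real, ← probReal_compl_eq_one_sub measurableSet_Iic, compl_Iic,
      ofReal_measureReal]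
  simp only [h1]
  have h2 : Tendsto (fun x => ENNReal.ofReal (1 - cdf ν x)) atTop (𝓝 (ENNReal.ofReal (1 - 1))) :=
    ENNReal.tendsto_ofReal (tendsto_const_nhds.sub (tendsto_cdf_atTop ν))
  simpa using h2

theorem ae_nonneg (hν : IsSubexponential ν) : ∀ᵐ x ∂ν, 0 ≤ x := by
  rw [ae_iff]
  convert hν.nonneg using 2
  ext x
  simp

theorem tail_of_neg (hν : IsSubexponential ν) {x : ℝ} (hx : x < 0) : ν (Ioi x) = 1 := by
  have := hν.isProbabilityMeasure
  rw [← prob_compl_eq_zero_iff (s := Ioi x) measurableSet_Ioi, compl_Ioi]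
  exact measure_mono_null (Iic_subset_Iio.2 hx) hν.nonneg

/-- Convolution tail split according to the size of the first summand. -/
theorem le_conv_tail (hν : IsSubexponential ν) {t u : ℝ} (htu : t ≤ u) :
    ν (Ioi u) + ν (Iic t) * ν (Ioi u) + ∫⁻ x in Ioc t u, ν (Ioi (u - x)) ∂ν
      ≤ (Measure.conv ν ν) (Ioi u) := by
  have := hν.isProbabilityMeasure
  rw [conv_Ioi, ← lintegral_add_compl (μ := ν) _ (measurableSet_Ioi (a := u)), compl_Ioi,
    ← Iic_union_Ioc_eq_Iic htu, lintegral_union measurableSet_Ioc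
      (Set.Iic_disjoint_Ioc le_rfl), add_assoc]
  refine add_le_add ?_ (add_le_add ?_ le_rfl)
  · calc ν (Ioi u) = ∫⁻ x in Ioi u, 1 ∂ν := by simp
      _ ≤ _ := setLIntegral_mono' measurableSet_Ioi fun x (hx : u < x) => by
        rw [hν.tail_of_neg (sub_neg.2 hx)]
  · calc ν (Iic t) * ν (Ioi u) = ∫⁻ x in Iic t, ν (Ioi u) ∂ν := by
          rw [setLIntegral_const, mul_comm]
      _ ≤ _ := lintegral_mono_ae <| (ae_restrict_of_ae hν.ae_nonneg).mono fun x hx =>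
        measure_Ioi_antitone ν (by linarith)

theorem eventually_conv_le (hν : IsSubexponential ν) {ε : ℝ} (hε : 0 < ε) :
    ∀ᶠ u in atTop, (Measure.conv ν ν) (Ioi u) ≤ (2 + ENNReal.ofReal ε) * ν (Ioi u) := by
  have := hν.isProbabilityMeasure
  filter_upwards [hν.tendsto_ratio.eventually_le_const (show (2 : ℝ) < 2 + ε by linarith)] with u hu
  have hpos : 0 < ν.real (Ioi u) :=
    ENNReal.toReal_pos (hν.tail_pos u).ne' (measure_ne_top _ _)
  rw [div_le_iff₀ hpos] at hu
  have h := ENNReal.ofReal_le_ofReal hu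
  rwa [ofReal_measureReal, ENNReal.ofReal_mul (by positivity), ofReal_measureReal,
    ENNReal.ofReal_add (by norm_num) hε.le, ENNReal.ofReal_ofNat] at h

/-- In a convolution tail of size about `2 ν(u, ∞)`, the parts `x > u` and `x ≤ t` already account
for `1 + ν(-∞, t]` of the factor `2`; only `ν(t, ∞)` is left for the middle. -/
theorem eventually_middle_le (hν : IsSubexponential ν) (t : ℝ) {ε : ℝ} (hε : 0 < ε) :
    ∀ᶠ u in atTop, ∫⁻ x in Ioc t u, ν (Ioi (u - x)) ∂ν
      ≤ (ν (Ioi t) + ENNReal.ofReal ε) * ν (Ioi u) := by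
  have := hν.isProbabilityMeasure
  filter_upwards [hν.eventually_conv_le hε, eventually_ge_atTop t] with u hu htu
  have h := (hν.le_conv_tail htu).trans hu
  have h1 : ν (Iic t) + ν (Ioi t) = 1 := by
    rw [← compl_Iic, prob_add_prob_compl measurableSet_Iic]
  have h2 : (2 + ENNReal.ofReal ε) * ν (Ioi u) = ν (Ioi u) + ν (Iic t) * ν (Ioi u) +
      (ν (Ioi t) + ENNReal.ofReal ε) * ν (Ioi u) := by
    rw [show (2 : ℝ≥0∞) = 1 + (ν (Iic t) + ν (Ioi t)) by rw [h1]; norm_num]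
    ring
  rw [h2] at h
  refine (ENNReal.add_le_add_iff_left ?_).1 h
  finiteness

/-- Subexponential laws are long tailed. -/
theorem eventually_tail_sub_le (hν : IsSubexponential ν) (t : ℝ) {r : ℝ} (hr : 1 < r) :
    ∀ᶠ u in atTop, ν (Ioi (u - t)) ≤ ENNReal.ofReal r * ν (Ioi u) := by
  have := hν.isProbabilityMeasure
  set a := ν.real (Ioi t) with ha
  have hapos : 0 < a := ENNReal.toReal_pos (hν.tail_pos t).ne' (measure_ne_top _ _)
  -- Chosen so that `(a + ε) / (a - ε) = r`. On `(t, u]` the integrand of the middle part is at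
  -- least `ν(u - t, ∞)`, and this interval has mass at least `a - ε`.
  set ε := a * (r - 1) / (r + 1) with hε
  have hεpos : 0 < ε := by
    have : 0 < r - 1 := by linarith
    positivity
  have hεeq : (a - ε) * r = a + ε := by
    rw [hε]
    field_simp
    ring
  have hsmall := hν.tendsto_tail.eventually_le_const (ENNReal.ofReal_pos.2 hεpos)
  filter_upwards [hν.eventually_middle_le t hεpos, hsmall, eventually_ge_atTop t]
    with u hu hs htu
  have h1 : ν (Ioc t u) * ν (Ioi (u - t)) ≤ (ν (Ioi t) + ENNReal.ofReal ε) * ν (Ioi u) := by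
    refine le_trans ?_ hu
    rw [mul_comm, ← setLIntegral_const]
    exact setLIntegral_mono' measurableSet_Ioc fun x hx =>
      measure_Ioi_antitone ν (by linarith [hx.1])
  have h2 : ν.real (Ioc t u) = a - ν.real (Ioi u) := by
    rw [← Ioi_sdiff_Ioi, measureReal_sdiff (Ioi_subset_Ioi htu) measurableSet_Ioi]
  have h3 : ν.real (Ioi u) ≤ ε := ENNReal.toReal_le_of_le_ofReal hεpos.le hs
  have h4 : ν.real (Ioc t u) * ν.real (Ioi (u - t)) ≤ (a + ε) * ν.real (Ioi u) := by
    have := ENNReal.toReal_mono (by finiteness) h1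
    rwa [ENNReal.toReal_mul, ENNReal.toReal_mul, ENNReal.toReal_add (by finiteness) (by finiteness),
      ENNReal.toReal_ofReal hεpos.le] at this
  have h5 : 0 < a - ε := by nlinarith
  have h6 : (a - ε) * ν.real (Ioi (u - t)) ≤ (a - ε) * (r * ν.real (Ioi u)) := by
    rw [← mul_assoc, hεeq]
    refine le_trans (mul_le_mul_of_nonneg_right ?_ measureReal_nonneg) h4
    rw [h2]
    linarith
  have h7 := ENNReal.ofReal_le_ofReal (le_of_mul_le_mul_left h6 h5)
  rwa [ENNReal.ofReal_mul (by linarith), ofReal_measureReal, ofReal_measureReal] at h7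

/-- This is the contraction factor of the renewal inequality: the middle of the convolution
contributes `2γ`, and the shifted tail another `2γ` by long-tailedness with ratio `2`. -/
theorem eventually_renewal_coeff_le (hν : IsSubexponential ν) {α γ : ℝ} (hα : 0 < α) (hγ : 0 < γ)
    {x₀ : ℝ} (hx : ENNReal.ofReal α * ν (Ioi x₀) ≤ ENNReal.ofReal γ) :
    ∀ᶠ u in atTop, ENNReal.ofReal α * (∫⁻ x in Ioc x₀ u, ν (Ioi (u - x)) ∂ν) +
      ENNReal.ofReal γ * ν (Ioi (u - x₀)) ≤ ENNReal.ofReal (4 * γ) * ν (Ioi u) := by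
  filter_upwards [hν.eventually_middle_le x₀ (div_pos hγ hα),
    hν.eventually_tail_sub_le x₀ (show (1 : ℝ) < 2 by norm_num)] with u h1 h2
  calc _ ≤ ENNReal.ofReal α * ((ν (Ioi x₀) + ENNReal.ofReal (γ / α)) * ν (Ioi u)) +
        ENNReal.ofReal γ * (ENNReal.ofReal 2 * ν (Ioi u)) := by gcongr
    _ = (ENNReal.ofReal α * ν (Ioi x₀) + ENNReal.ofReal γ + ENNReal.ofReal (γ * 2)) *
          ν (Ioi u) := by
        rw [show ENNReal.ofReal γ = ENNReal.ofReal α * ENNReal.ofReal (γ / α) by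
          rw [← ENNReal.ofReal_mul hα.le, mul_div_cancel₀ _ hα.ne'], ENNReal.ofReal_mul hγ.le,
          show ENNReal.ofReal γ = ENNReal.ofReal α * ENNReal.ofReal (γ / α) by
          rw [← ENNReal.ofReal_mul hα.le, mul_div_cancel₀ _ hα.ne']]
        ring
    _ ≤ (ENNReal.ofReal γ + ENNReal.ofReal γ + ENNReal.ofReal (γ * 2)) * ν (Ioi u) := by gcongr
    _ = _ := by
        rw [← ENNReal.ofReal_add hγ.le hγ.le, ← ENNReal.ofReal_add (by positivity) (by positivity)]
        congr 2
        ring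

/-! ### The renewal inequality with a subexponential tail. -/

/-- Solutions of the renewal inequality are uniformly dominated by the tail of `ν`. -/
theorem exists_uniform_bound (hν : IsSubexponential ν) {w : ℕ → ℝ → ℝ≥0∞}
    (hw : ∀ N u, w N u ≤ 1) (hw0 : ∀ u, 0 ≤ u → w 0 u = 0) {α γ x₀ k : ℝ} (hα : 0 < α)
    (hγ : 0 < γ) (hγ1 : 4 * γ ≤ 1 / 2)
    (hx : ENNReal.ofReal α * ν (Ioi x₀) ≤ ENNReal.ofReal γ)
    (hrec : ∀ N u, k ≤ u → w (N + 1) u ≤ ENNReal.ofReal γ * w N (u - x₀) +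
      ENNReal.ofReal α * ∫⁻ x in Ioi x₀, w N (u - x) ∂ν) :
    ∃ K : ℝ, 0 ≤ K ∧ ∀ N u, 0 ≤ u → w N u ≤ ENNReal.ofReal K * ν (Ioi u) := by
  have := hν.isProbabilityMeasure
  obtain ⟨u₀, hu₀⟩ := eventually_atTop.1 ((hν.eventually_renewal_coeff_le hα hγ hx).and
    ((eventually_ge_atTop k).and (eventually_ge_atTop x₀)))
  have hpos : 0 < ν.real (Ioi u₀) :=
    ENNReal.toReal_pos (hν.tail_pos u₀).ne' (measure_ne_top _ _)
  -- The second entry makes the bound at least `1` for `u ≤ u₀`; the first gives `4γK + α ≤ K/2 + α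
  -- ≤ K`, which closes the induction.
  refine ⟨max (2 * α) (ν.real (Ioi u₀))⁻¹, by positivity, fun N => ?_⟩
  set K := max (2 * α) (ν.real (Ioi u₀))⁻¹ with hK
  have hKpos : 0 < K := lt_max_of_lt_left (by positivity)
  induction N with
  | zero =>
    intro u hu
    rw [hw0 u hu]
    exact zero_le
  | succ N ih =>
    intro u hu
    rcases le_total u u₀ with h | h
    · refine (hw _ _).trans ?_
      calc (1 : ℝ≥0∞) = ENNReal.ofReal ((ν.real (Ioi u₀))⁻¹) * ν (Ioi u₀) := by
            rw [← ofReal_measureReal, ← ENNReal.ofReal_mul (by positivity),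
              inv_mul_cancel₀ hpos.ne', ENNReal.ofReal_one]
        _ ≤ _ := mul_le_mul' (ENNReal.ofReal_le_ofReal (le_max_right _ _))
          (measure_Ioi_antitone ν h)
    · obtain ⟨h1, h2, h3⟩ := hu₀ u h
      refine (hrec N u h2).trans ((renewal_step_le ν (hw N) ih le_rfl (by linarith)).trans ?_)
      rw [sub_zero]
      calc _ ≤ ENNReal.ofReal K * (ENNReal.ofReal (4 * γ) * ν (Ioi u)) +
            ENNReal.ofReal α * ν (Ioi u) := by gcongr
        _ = ENNReal.ofReal (K * (4 * γ) + α) * ν (Ioi u) := by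
            rw [← mul_assoc, ← ENNReal.ofReal_mul hKpos.le, ← add_mul,
              ← ENNReal.ofReal_add (by positivity) hα.le]
        _ ≤ _ := by
            gcongr
            have : 2 * α ≤ K := le_max_left _ _
            nlinarith

/-- Sharp asymptotic bound for solutions of the renewal inequality. -/
theorem eventually_iSup_le (hν : IsSubexponential ν) {w : ℕ → ℝ → ℝ≥0∞}
    (hw : ∀ N u, w N u ≤ 1) (hmono : ∀ u, Monotone fun N => w N u)
    (hw0 : ∀ u, 0 ≤ u → w 0 u = 0) {α γ x₀ k : ℝ} (hα : 0 < α)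
    (hγ : 0 < γ) (hγ1 : 4 * γ ≤ 1 / 2)
    (hx : ENNReal.ofReal α * ν (Ioi x₀) ≤ ENNReal.ofReal γ)
    (hrec : ∀ N u, k ≤ u → w (N + 1) u ≤ ENNReal.ofReal γ * w N (u - x₀) +
      ENNReal.ofReal α * ∫⁻ x in Ioi x₀, w N (u - x) ∂ν) {b : ℝ} (hb : α / (1 - 4 * γ) < b) :
    ∀ᶠ u in atTop, ⨆ N, w N u ≤ ENNReal.ofReal b * ν (Ioi u) := by
  have := hν.isProbabilityMeasure
  set W : ℝ → ℝ≥0∞ := fun u => ⨆ N, w N u with hW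
  have hW1 : ∀ u, W u ≤ 1 := fun u => iSup_le fun N => hw N u
  have hWrec : ∀ u, k ≤ u → W u ≤ ENNReal.ofReal γ * W (u - x₀) +
      ENNReal.ofReal α * ∫⁻ x in Ioi x₀, W (u - x) ∂ν := fun u hu => by
    refine iSup_le fun N => (hmono u N.le_succ).trans ((hrec N u hu).trans ?_)
    gcongr
    · exact le_iSup (fun N => w N (u - x₀)) N
    · exact le_iSup (fun N => w N (u - _)) N
  -- The admissible asymptotic constants. The uniform bound provides one, and the inequality sends
  -- each `b` to `4γb + rα`, so the infimum is at most the fixed point of this map as `r ↓ 1`.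
  set S : Set ℝ := {b | 0 ≤ b ∧ ∀ᶠ u in atTop, W u ≤ ENNReal.ofReal b * ν (Ioi u)} with hS
  have hSne : S.Nonempty := by
    obtain ⟨K, hK, h⟩ := hν.exists_uniform_bound hw hw0 hα hγ hγ1 hx hrec
    refine ⟨K, hK, ?_⟩
    filter_upwards [eventually_ge_atTop 0] with u hu
    exact iSup_le fun N => h N u hu
  have hSbdd : BddBelow S := ⟨0, fun _ h => h.1⟩
  have hstep : ∀ r, 1 < r → ∀ b ∈ S, 4 * γ * b + r * α ∈ S := by
    rintro r hr b ⟨hb0, hb⟩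
    refine ⟨by positivity, ?_⟩
    obtain ⟨u₁, hu₁⟩ := eventually_atTop.1 (hb.and (eventually_ge_atTop 0))
    filter_upwards [hν.eventually_renewal_coeff_le hα hγ hx, hν.eventually_tail_sub_le u₁ hr,
      eventually_ge_atTop k, eventually_ge_atTop (x₀ + u₁)] with u h1 h2 h3 h4
    refine (hWrec u h3).trans ((renewal_step_le ν hW1 (fun y hy => (hu₁ y hy).1)
      (hu₁ u₁ le_rfl).2 h4).trans ?_)
    calc _ ≤ ENNReal.ofReal b * (ENNReal.ofReal (4 * γ) * ν (Ioi u)) +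
            ENNReal.ofReal α * (ENNReal.ofReal r * ν (Ioi u)) := by gcongr
      _ = _ := by
        rw [← mul_assoc, ← ENNReal.ofReal_mul hb0, ← mul_assoc (ENNReal.ofReal α),
          ← ENNReal.ofReal_mul hα.le, ← add_mul, ← ENNReal.ofReal_add (by positivity) (by positivity)]
        congr 2
        ring
  have hq : 0 < 1 - 4 * γ := by linarith
  have hinf : sInf S < b := by
    refine lt_of_le_of_lt ?_ hb
    rw [le_div_iff₀ hq]
    refine le_of_forall_gt_imp_ge_of_dense fun a ha => ?_
    have hr : 1 < a / α := (one_lt_div hα).2 ha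
    have h1 : (sInf S - a) / (4 * γ) ≤ sInf S := le_csInf hSne fun b hb => by
      rw [div_le_iff₀ (by positivity)]
      have := csInf_le hSbdd (hstep _ hr b hb)
      rw [div_mul_cancel₀ _ hα.ne'] at this
      linarith
    rw [div_le_iff₀ (by positivity)] at h1
    linarith
  obtain ⟨b', hb', hlt⟩ := exists_lt_of_csInf_lt hSne hinf
  filter_upwards [hb'.2] with u hu
  refine hu.trans ?_
  gcongr

end IsSubexponential

/-! ### Reduction of the risk region to a real functional. -/

/-- Continuous, subadditive and monotone real functions on `ℝ^d` vanishing at the origin. -/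
structure IsMonotoneSubadditive {d : ℕ} (g : (Fin d → ℝ) → ℝ) : Prop where
  continuous : Continuous g
  map_add_le : ∀ x y, g (x + y) ≤ g x + g y
  monotone : Monotone g
  map_zero : g 0 = 0

/-- A risk region is described by a superlevel set of the gauge of its complement. -/
theorem IsRiskRegion.exists_functional {d : ℕ} {A : Set (Fin d → ℝ)} (hA : IsRiskRegion A) :
    ∃ g : (Fin d → ℝ) → ℝ, IsMonotoneSubadditive g ∧
      ∀ u : ℝ, 0 < u → ∀ x, x ∈ u • A ↔ u < g x := by
  have hnhds : Aᶜ ∈ 𝓝 (0 : Fin d → ℝ) :=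
    mem_of_superset (isClosed_closure.isOpen_compl.mem_nhds hA.zero_notMem_closure)
      (compl_subset_compl.2 subset_closure)
  have hclosed : IsClosed Aᶜ := hA.isOpen.isClosed_compl
  have hmem : ∀ u : ℝ, 0 < u → ∀ x, x ∈ u • A ↔ u < gauge Aᶜ x := fun u hu x => by
    rw [mem_smul_set_iff_inv_smul_mem₀ hu.ne', ← not_iff_not, ← mem_compl_iff,
      ← hclosed.closure_eq, ← gauge_le_one_iff_mem_closure hA.convex_compl hnhds,
      hclosed.closure_eq, gauge_smul_of_nonneg (by positivity), smul_eq_mul, not_lt,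
      inv_mul_le_iff₀ hu, mul_one]
  refine ⟨gauge Aᶜ, ⟨continuous_gauge hA.convex_compl hnhds,
    gauge_add_le hA.convex_compl (absorbent_nhds_zero hnhds), fun x y hxy => ?_, gauge_zero⟩, hmem⟩
  -- Monotonicity is read off the level sets: a level strictly between the two values contradicts
  -- that `A` is increasing.
  by_contra! h
  obtain ⟨u, hu1, hu2⟩ := exists_between h
  have hu : 0 < u := (gauge_nonneg y).trans_lt hu1
  have hx := (hmem u hu x).2 hu2
  rw [mem_smul_set_iff_inv_smul_mem₀ hu.ne'] at hx
  have hy : u⁻¹ • y ∈ A := hA.increasing (smul_le_smul_of_nonneg_left hxy (by positivity)) hx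
  rw [← mem_smul_set_iff_inv_smul_mem₀ hu.ne', hmem u hu] at hy
  exact lt_asymm hy hu1

/-- `∫_0^∞ F {x | u < g (x - v c)} dv`. -/
noncomputable def functionalTail {d : ℕ} (F : Measure (Fin d → ℝ)) (c : Fin d → ℝ)
    (g : (Fin d → ℝ) → ℝ) (u : ℝ) : ℝ≥0∞ :=
  ∫⁻ v in Ioi (0 : ℝ), F {x | u < g (x - v • c)}

section

variable {d : ℕ} {F : Measure (Fin d → ℝ)} {c : Fin d → ℝ} {g : (Fin d → ℝ) → ℝ}

theorem IsMonotoneSubadditive.antitone_shift (hg : IsMonotoneSubadditive g) (hc : 0 ≤ c)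
    (u : ℝ) : Antitone fun v : ℝ => F {x | u < g (x - v • c)} := fun _ _ hvw =>
  measure_mono fun x (hx : u < _) => hx.trans_le <| hg.monotone <|
    sub_le_sub_left (smul_le_smul_of_nonneg_right hvw hc) x

theorem image_add_smul_set {A : Set (Fin d → ℝ)} {u : ℝ}
    (hA : ∀ x, x ∈ u • A ↔ u < g x) (v : ℝ) :
    (fun x => x + v • c) '' (u • A) = {x | u < g (x - v • c)} := by
  ext x
  simp only [mem_image, mem_ofPred_eq, ← hA]
  constructor
  · rintro ⟨y, hy, rfl⟩
    simpa using hy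
  · intro h
    exact ⟨_, h, by simp⟩

theorem tailIntegral_eq [IsFiniteMeasure F] (hg : IsMonotoneSubadditive g) (hc : 0 ≤ c)
    {A : Set (Fin d → ℝ)} {u : ℝ} (hA : ∀ x, x ∈ u • A ↔ u < g x) :
    tailIntegral F c A u = (functionalTail F c g u).toReal := by
  simp only [tailIntegral, image_add_smul_set hA, functionalTail, measureReal_def]
  exact integral_toReal (hg.antitone_shift hc u).measurable.aemeasurable
    (ae_of_all _ fun v => measure_lt_top _ _)

/-- The constant `θ` is the mass of the shift measure on `E`. That it is positive and finite follows
from membership in the class, since a subexponential tail never vanishes. -/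
theorem exists_tail_law_of_memSubexpClass [SFinite F] (hg : IsMonotoneSubadditive g)
    {A : Set (Fin d → ℝ)} (hAo : IsOpen A) (hA : ∀ u : ℝ, 0 < u → ∀ x, x ∈ u • A ↔ u < g x)
    (hFI : MemSubexpClass A (integratedTail F c)) :
    ∃ (ν : Measure ℝ) (θ : ℝ), IsSubexponential ν ∧ 0 < θ ∧
      ∀ u, 0 < u → functionalTail F c g u = ENNReal.ofReal θ * ν (Ioi u) := by
  obtain ⟨ν, hν, hcdf⟩ := hFI
  have := hν.isProbabilityMeasure
  set μ := shiftMeasure F c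
  set E : Set (Fin d → ℝ) := {x | ∃ j, 0 < x j} with hEdef
  have hE : MeasurableSet E := by
    rw [hEdef, ofPred_exists]
    exact MeasurableSet.iUnion fun j => measurableSet_lt measurable_const (measurable_pi_apply j)
  have hsub : ∀ u : ℝ, 0 < u → u • A ⊆ E := fun u hu x hx => by
    by_contra hn
    simp only [hEdef, mem_ofPred_eq, not_exists, not_lt] at hn
    have h1 := hg.monotone (show x ≤ 0 from hn)
    rw [hg.map_zero] at h1
    linarith [(hA u hu x).1 hx]
  have hmeas : ∀ u : ℝ, 0 < u → MeasurableSet (u • A) := fun u hu =>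
    (hAo.smul₀ hu.ne').measurableSet
  have hμ : ∀ u : ℝ, 0 < u → μ (u • A) = functionalTail F c g u := fun u hu => by
    rw [shiftMeasure_apply F c (hmeas u hu)]
    simp only [image_add_smul_set (hA u hu), functionalTail]
  have htail : ∀ u : ℝ, 0 < u → ν.real (Ioi u) = (integratedTail F c).real (u • A) := fun u hu => by
    rw [← compl_Iic, probReal_compl_eq_one_sub measurableSet_Iic, ← cdf_eq_real, hcdf u hu]
    ring
  have hcond : ∀ u : ℝ, 0 < u → integratedTail F c (u • A) = (μ E)⁻¹ * functionalTail F c g u :=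
    fun u hu => by
      rw [integratedTail, ProbabilityTheory.cond_apply hE, inter_eq_right.2 (hsub u hu), hμ u hu]
  have hpos : 0 < (integratedTail F c).real ((1 : ℝ) • A) := by
    rw [← htail 1 one_pos]
    exact ENNReal.toReal_pos (hν.tail_pos 1).ne' (measure_ne_top _ _)
  -- Conditioning on a set of measure `0` or `∞` would give `u • A` the value `0`, the latter
  -- because `∞⁻¹ = 0`.
  have h0 : μ E ≠ 0 := fun h => by
    rw [integratedTail, ProbabilityTheory.cond, Measure.restrict_eq_zero.2 h] at hpos
    simp at hpos
  have htop : μ E ≠ ∞ := fun h => by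
    rw [measureReal_def, hcond 1 one_pos, h] at hpos
    simp at hpos
  refine ⟨ν, (μ E).toReal, hν, ENNReal.toReal_pos h0 htop, fun u hu => ?_⟩
  have hfin : integratedTail F c (u • A) ≠ ∞ := by
    rw [hcond u hu]
    refine ENNReal.mul_ne_top (ENNReal.inv_ne_top.2 h0) ?_
    rw [← hμ u hu]
    exact measure_ne_top_of_subset (hsub u hu) htop
  have h1 : ν (Ioi u) = integratedTail F c (u • A) :=
    (ENNReal.toReal_eq_toReal_iff' (measure_ne_top _ _) hfin).1 (htail u hu)
  rw [h1, hcond u hu, ENNReal.ofReal_toReal htop, ← mul_assoc, ENNReal.mul_inv_cancel h0 htop,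
    one_mul]

end

/-! ### Comparison of sums over a grid with integrals. -/

theorem pairwise_disjoint_Ioc_nat_mul {a : ℝ} (ha : 0 < a) :
    Pairwise (Function.onFun Disjoint fun n : ℕ => Ioc (n * a) ((n + 1) * a)) := by
  have hm : Monotone fun n : ℕ => (n : ℝ) * a := fun m n h => by
    have : (m : ℝ) ≤ n := by exact_mod_cast h
    exact mul_le_mul_of_nonneg_right this ha.le
  simpa using hm.pairwise_disjoint_on_Ioc_succ

theorem mul_tsum_le_lintegral_Ioi {a : ℝ} (ha : 0 < a) {f : ℝ → ℝ≥0∞} {φ : ℕ → ℝ≥0∞}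
    (h : ∀ n : ℕ, ∀ v ∈ Ioc (n * a) ((n + 1) * a), φ n ≤ f v) :
    ENNReal.ofReal a * ∑' n, φ n ≤ ∫⁻ v in Ioi 0, f v := by
  calc ENNReal.ofReal a * ∑' n, φ n
      = ∑' n : ℕ, ∫⁻ _ in Ioc (n * a) ((n + 1) * a), φ n := by
        rw [← ENNReal.tsum_mul_left]
        congr 1
        ext n
        rw [setLIntegral_const, Real.volume_Ioc, mul_comm]
        congr 2
        ring
    _ ≤ ∑' n : ℕ, ∫⁻ v in Ioc (n * a) ((n + 1) * a), f v :=
        ENNReal.tsum_le_tsum fun n => setLIntegral_mono' measurableSet_Ioc (h n)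
    _ = ∫⁻ v in ⋃ n : ℕ, Ioc (n * a) ((n + 1) * a), f v :=
        (lintegral_iUnion (fun n => measurableSet_Ioc) (pairwise_disjoint_Ioc_nat_mul ha) _).symm
    _ ≤ _ := lintegral_mono_set <| iUnion_subset fun n v hv =>
        lt_of_le_of_lt (by positivity) hv.1

theorem lintegral_Ioi_le_mul_tsum {a : ℝ} (ha : 0 < a) {f : ℝ → ℝ≥0∞} {φ : ℕ → ℝ≥0∞}
    (h : ∀ n : ℕ, ∀ v ∈ Ioc (n * a) ((n + 1) * a), f v ≤ φ n) :
    ∫⁻ v in Ioi 0, f v ≤ ENNReal.ofReal a * ∑' n, φ n := by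
  have hsub : Ioi 0 ⊆ ⋃ n : ℕ, Ioc (n * a) ((n + 1) * a) := fun v hv => by
    have hpos : 0 < v / a := div_pos hv ha
    obtain ⟨n, hn⟩ := Nat.exists_eq_add_of_lt (Nat.ceil_pos.2 hpos)
    have h1 := Nat.ceil_lt_add_one hpos.le
    have h2 := Nat.le_ceil (v / a)
    rw [hn] at h1 h2
    push_cast at h1 h2
    refine mem_iUnion.2 ⟨n, ?_, ?_⟩
    · rw [← lt_div_iff₀ ha]
      linarith
    · rw [← div_le_iff₀ ha]
      linarith
  calc _ ≤ ∫⁻ v in ⋃ n : ℕ, Ioc (n * a) ((n + 1) * a), f v := lintegral_mono_set hsub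
    _ ≤ ∑' n : ℕ, ∫⁻ v in Ioc (n * a) ((n + 1) * a), f v := lintegral_iUnion_le _ _
    _ ≤ ∑' n : ℕ, ∫⁻ _ in Ioc (n * a) ((n + 1) * a), φ n :=
        ENNReal.tsum_le_tsum fun n => setLIntegral_mono' measurableSet_Ioc (h n)
    _ = _ := by
        rw [← ENNReal.tsum_mul_left]
        congr 1
        ext n
        rw [setLIntegral_const, Real.volume_Ioc, mul_comm]
        congr 2
        ring

/-! ### Independence of past and future, and the law of large numbers. -/

section

variable {Ω : Type*} [MeasurableSpace Ω] {P : Measure Ω}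

/-- Two independent sequences of independent variables form a sequence of independent pairs. -/
theorem iIndepFun_prodMk {ι α β : Type*} [MeasurableSpace α] [MeasurableSpace β]
    {X : ι → Ω → α} {Y : ι → Ω → β} (hXm : ∀ i, Measurable (X i)) (hYm : ∀ i, Measurable (Y i))
    (hX : iIndepFun X P) (hY : iIndepFun Y P)
    (hXY : IndepFun (fun ω i => X i ω) (fun ω i => Y i ω) P) :
    iIndepFun (fun i ω => (X i ω, Y i ω)) P := by
  have hinter : ∀ (s : Finset ι) (a : ι → Set α) (b : ι → Set β), (∀ i, MeasurableSet (a i)) →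
      (∀ i, MeasurableSet (b i)) → P (⋂ i ∈ s, (X i ⁻¹' a i ∩ Y i ⁻¹' b i)) =
        (∏ i ∈ s, P (X i ⁻¹' a i)) * ∏ i ∈ s, P (Y i ⁻¹' b i) := by
    intro s a b ha hb
    have h1 : (⋂ i ∈ s, (X i ⁻¹' a i ∩ Y i ⁻¹' b i)) =
        (fun ω i => X i ω) ⁻¹' (⋂ i ∈ s, (fun x => x i) ⁻¹' a i) ∩
        (fun ω i => Y i ω) ⁻¹' (⋂ i ∈ s, (fun x => x i) ⁻¹' b i) := by
      ext ω
      simp [forall_and]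
    have hma : MeasurableSet (⋂ i ∈ s, (fun x : ι → α => x i) ⁻¹' a i) :=
      Finset.measurableSet_biInter s fun i _ => measurable_pi_apply i (ha i)
    have hmb : MeasurableSet (⋂ i ∈ s, (fun x : ι → β => x i) ⁻¹' b i) :=
      Finset.measurableSet_biInter s fun i _ => measurable_pi_apply i (hb i)
    rw [h1, hXY.measure_inter_preimage_eq_mul _ _ hma hmb]
    simp only [preimage_iInter]
    rw [← hX.measure_inter_preimage_eq_mul s (fun i _ => ha i),
      ← hY.measure_inter_preimage_eq_mul s (fun i _ => hb i)]
    rfl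
  -- Rectangles form a π-system generating the product σ-algebra, so the factorization on rectangles
  -- suffices.
  rw [iIndepFun_iff_iIndep]
  refine iIndepSets.iIndep (fun i => ((hXm i).prodMk (hYm i)).comap_le)
    (fun i => (fun S => (fun ω => (X i ω, Y i ω)) ⁻¹' S) ''
      image2 (· ×ˢ ·) {s : Set α | MeasurableSet s} {t : Set β | MeasurableSet t})
    (fun i => ?_) (fun i => ?_) ?_
  · exact isPiSystem_prod.comap _
  · rw [← generateFrom_prod, MeasurableSpace.comap_generateFrom]
  · rw [iIndepSets_iff]
    intro s f hf
    have : ∀ i, ∃ (a : Set α) (b : Set β), MeasurableSet a ∧ MeasurableSet b ∧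
        (i ∈ s → f i = X i ⁻¹' a ∩ Y i ⁻¹' b) := fun i => by
      by_cases hi : i ∈ s
      · obtain ⟨_, ⟨a, ha, b, hb, rfl⟩, h⟩ := hf i hi
        exact ⟨a, b, ha, hb, fun _ => by rw [← h]; rfl⟩
      · exact ⟨∅, ∅, .empty, .empty, fun h => absurd h hi⟩
    choose a b ha hb hab using this
    have h1 : ⋂ i ∈ s, f i = ⋂ i ∈ s, (X i ⁻¹' a i ∩ Y i ⁻¹' b i) :=
      iInter₂_congr fun i hi => hab i hi
    rw [h1, hinter s a b ha hb, ← Finset.prod_mul_distrib]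
    refine Finset.prod_congr rfl fun i hi => ?_
    have := hinter {i} a b ha hb
    simp only [Finset.mem_singleton, iInter_iInter_eq_left, Finset.prod_singleton] at this
    rw [hab i hi, this]

/-- The first `n` terms of a sequence, followed by zeros. -/
def truncateSeq {E : Type*} [Zero E] (n : ℕ) (z : ℕ → E) : ℕ → E :=
  fun i => if i < n then z i else 0

theorem measurable_truncateSeq {E : Type*} [Zero E] [MeasurableSpace E] (n : ℕ) :
    Measurable (truncateSeq n : (ℕ → E) → ℕ → E) := by
  refine measurable_pi_iff.2 fun i => ?_
  unfold truncateSeq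
  split_ifs <;> fun_prop

/-- Disjoint blocks of indices generate independent σ-algebras. Padding by zeros keeps the past in
the full sequence space, where events about walks are defined. -/
theorem indepFun_past_future {E : Type*} [Zero E] [MeasurableSpace E] {V : ℕ → Ω → E}
    (hVm : ∀ i, Measurable (V i)) (hV : iIndepFun V P) (n : ℕ) :
    IndepFun (fun ω => truncateSeq n fun i => V i ω) (fun ω i => V (n + i) ω) P := by
  have h := indep_iSup_of_disjoint (fun i => (hVm i).comap_le) ((iIndepFun_iff_iIndep _ _ _).1 hV)
    (S := Iio n) (T := Ici n) (disjoint_left.2 fun i h1 h2 => not_lt_of_ge (mem_Ici.1 h2) (mem_Iio.1 h1))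
  rw [IndepFun_iff_Indep]
  refine indep_of_indep_of_le_left (indep_of_indep_of_le_right h ?_) ?_
  · refine Measurable.comap_le (m₁ := ⨆ i ∈ Ici n, MeasurableSpace.comap (V i) inferInstance) ?_
    refine @measurable_pi_lambda _ _ _ (_) _ _ fun i => ?_
    exact Measurable.mono (comap_measurable _)
      (le_iSup₂_of_le (n + i) (mem_Ici.2 (Nat.le_add_right n i)) le_rfl) le_rfl
  · refine Measurable.comap_le (m₁ := ⨆ i ∈ Iio n, MeasurableSpace.comap (V i) inferInstance) ?_
    refine @measurable_pi_lambda _ _ _ (_) _ _ fun i => ?_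
    unfold truncateSeq
    split_ifs with hi
    · exact Measurable.mono (comap_measurable _) (le_iSup₂_of_le i (mem_Iio.2 hi) le_rfl) le_rfl
    · exact @measurable_const _ _ _ (_) _

theorem map_shift_eq [IsProbabilityMeasure P] {E : Type*} [MeasurableSpace E] {V : ℕ → Ω → E}
    (hVm : ∀ i, Measurable (V i)) (hV : iIndepFun V P)
    (hVid : ∀ i, IdentDistrib (V i) (V 0) P P) (n : ℕ) :
    P.map (fun ω i => V (n + i) ω) = P.map (fun ω i => V i ω) := by
  have h := hV.precomp (g := fun i => n + i) (add_right_injective n)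
  rw [hV.map_fun_eq_infinitePi_map hVm, iIndepFun.map_fun_eq_infinitePi_map (fun i => hVm _) h]
  congr 1
  ext1 i
  rw [(hVid i).map_eq]
  exact (hVid (n + i)).map_eq

/-- Continuity from above: an almost surely finite random threshold can be replaced by a
deterministic one, outside an event of small probability. -/
theorem exists_measure_compl_le [IsFiniteMeasure P] {S : ℕ → Set Ω} (hS : Monotone S)
    (hSm : ∀ r, MeasurableSet (S r)) (h : ∀ᵐ ω ∂P, ∃ r, ω ∈ S r) {γ : ℝ} (hγ : 0 < γ) :
    ∃ r, P (S r)ᶜ ≤ ENNReal.ofReal γ := by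
  have h1 : Tendsto (fun r => P (S r)ᶜ) atTop (𝓝 (P (⋂ r, (S r)ᶜ))) :=
    tendsto_measure_iInter_atTop (fun r => (hSm r).compl.nullMeasurableSet)
      (fun _ _ hrs => compl_subset_compl.2 (hS hrs)) ⟨0, measure_ne_top _ _⟩
  have h2 : P (⋂ r, (S r)ᶜ) = 0 := by
    rw [← compl_iUnion]
    convert ae_iff.1 h using 2
    ext ω
    simp
  rw [h2] at h1
  exact (h1.eventually_le_const (ENNReal.ofReal_pos.2 hγ)).exists

/-- With probability close to one, the random walk with drift `-c` stays between two lines. -/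
theorem exists_walk_envelope [IsProbabilityMeasure P] {d : ℕ} {Z : ℕ → Ω → Fin d → ℝ}
    (hZm : ∀ i, Measurable (Z i)) (hZ : iIndepFun Z P)
    (hZid : ∀ i, IdentDistrib (Z i) (Z 0) P P) (hZint : Integrable (Z 0) P)
    {c : Fin d → ℝ} (hc : c = -∫ ω, Z 0 ω ∂P) (hcpos : ∀ j, 0 < c j) {ε γ : ℝ} (hε : 0 < ε)
    (hγ : 0 < γ) :
    ∃ r : ℕ, P {ω | ∀ n : ℕ, (∑ i ∈ Finset.range n, Z i ω) ≤
        (fun _ => (r : ℝ)) - ((n : ℝ) * (1 - ε)) • c ∧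
      (-(fun _ => (r : ℝ)) - ((n : ℝ) * (1 + ε)) • c) ≤ ∑ i ∈ Finset.range n, Z i ω}ᶜ
        ≤ ENNReal.ofReal γ := by
  have hsum : ∀ n, Measurable fun ω => ∑ i ∈ Finset.range n, Z i ω := fun n => by fun_prop
  refine exists_measure_compl_le (S := fun r : ℕ => {ω | ∀ n : ℕ, (∑ i ∈ Finset.range n, Z i ω) ≤
        (fun _ => (r : ℝ)) - ((n : ℝ) * (1 - ε)) • c ∧
      (-(fun _ => (r : ℝ)) - ((n : ℝ) * (1 + ε)) • c) ≤ ∑ i ∈ Finset.range n, Z i ω})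
    ?_ (fun r => ?_) ?_ hγ
  · intro r s hrs ω hω n
    have hrs' : (fun _ : Fin d => (r : ℝ)) ≤ fun _ => (s : ℝ) := fun _ => Nat.cast_le.2 hrs
    exact ⟨(hω n).1.trans (sub_le_sub_right hrs' _),
      (sub_le_sub_right (neg_le_neg hrs') _).trans (hω n).2⟩
  · simp only [ofPred_forall]
    exact MeasurableSet.iInter fun n =>
      (measurableSet_le (hsum n) measurable_const).inter
        (measurableSet_le measurable_const (hsum n))
  · have hslln := strong_law_ae Z hZint (fun i j hij => hZ.indepFun hij) hZid
    filter_upwards [hslln] with ω hω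
    have hlim : Tendsto (fun n : ℕ => (n : ℝ)⁻¹ • ∑ i ∈ Finset.range n, Z i ω) atTop (𝓝 (-c)) := by
      rwa [hc, neg_neg]
    have hev : ∀ᶠ n : ℕ in atTop, ∀ j, -((1 + ε) * c j) < (n : ℝ)⁻¹ * ∑ i ∈ Finset.range n, Z i ω j ∧
        (n : ℝ)⁻¹ * ∑ i ∈ Finset.range n, Z i ω j < -((1 - ε) * c j) := by
      refine eventually_all.2 fun j => ?_
      have hj := tendsto_pi_nhds.1 hlim j
      simp only [Pi.smul_apply, Finset.sum_apply, smul_eq_mul, Pi.neg_apply] at hj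
      have := mul_pos hε (hcpos j)
      exact (hj.eventually_const_lt (by linarith)).and (hj.eventually_lt_const (by linarith))
    obtain ⟨N, hN⟩ := eventually_atTop.1 (hev.and (eventually_gt_atTop 0))
    -- From time `N` on the limit theorem keeps the walk between the lines through the origin; `r`
    -- only has to absorb the finitely many earlier deviations, hence their sum.
    obtain ⟨r, hr⟩ := exists_nat_ge (∑ n ∈ Finset.range N, ∑ j,
      (|∑ i ∈ Finset.range n, Z i ω j + (n : ℝ) * (1 - ε) * c j| +
        |∑ i ∈ Finset.range n, Z i ω j + (n : ℝ) * (1 + ε) * c j|))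
    have hr0 : (0 : ℝ) ≤ r := Nat.cast_nonneg r
    refine ⟨r, fun n => ?_⟩
    simp only [Pi.le_def, Pi.sub_apply, Pi.smul_apply, Pi.neg_apply, Finset.sum_apply, smul_eq_mul,
      ← forall_and]
    intro j
    rcases lt_or_ge n N with hn | hn
    · have h1 : |∑ i ∈ Finset.range n, Z i ω j + (n : ℝ) * (1 - ε) * c j| +
          |∑ i ∈ Finset.range n, Z i ω j + (n : ℝ) * (1 + ε) * c j| ≤ r := by
        refine le_trans ?_ hr
        refine le_trans ?_ (Finset.single_le_sum (f := fun n => ∑ j,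
          (|∑ i ∈ Finset.range n, Z i ω j + (n : ℝ) * (1 - ε) * c j| +
          |∑ i ∈ Finset.range n, Z i ω j + (n : ℝ) * (1 + ε) * c j|))
          (fun i _ => by positivity) (Finset.mem_range.2 hn))
        exact Finset.single_le_sum (f := fun j =>
          (|∑ i ∈ Finset.range n, Z i ω j + (n : ℝ) * (1 - ε) * c j| +
          |∑ i ∈ Finset.range n, Z i ω j + (n : ℝ) * (1 + ε) * c j|))
          (fun i _ => by positivity) (Finset.mem_univ j)
      have h2 := le_abs_self (∑ i ∈ Finset.range n, Z i ω j + (n : ℝ) * (1 - ε) * c j)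
      have h3 := neg_abs_le (∑ i ∈ Finset.range n, Z i ω j + (n : ℝ) * (1 + ε) * c j)
      have h4 := abs_nonneg (∑ i ∈ Finset.range n, Z i ω j + (n : ℝ) * (1 - ε) * c j)
      have h5 := abs_nonneg (∑ i ∈ Finset.range n, Z i ω j + (n : ℝ) * (1 + ε) * c j)
      constructor <;> linarith
    · obtain ⟨h, hpos⟩ := hN n hn
      have hn0 : (0 : ℝ) < n := Nat.cast_pos.2 hpos
      obtain ⟨h1, h2⟩ := h j
      rw [← div_eq_inv_mul, lt_div_iff₀ hn0] at h1
      rw [← div_eq_inv_mul, div_lt_iff₀ hn0] at h2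
      constructor <;> nlinarith

end

/-! ### Decomposition of the walk at its first exit. -/

/-- Partial sums of a sequence of vectors. -/
def walk {d : ℕ} (z : ℕ → Fin d → ℝ) (n : ℕ) : Fin d → ℝ :=
  ∑ i ∈ Finset.range n, z i

/-- The largest value of `g` along the first `N` steps of the walk. -/
noncomputable def maxWalk {d : ℕ} (g : (Fin d → ℝ) → ℝ) (N : ℕ) (z : ℕ → Fin d → ℝ) : ℝ :=
  (Finset.range (N + 1)).sup' Finset.nonempty_range_add_one fun n => g (walk z n)

/-- Sequences whose walk first fails to be below the line `ρ - t a c` at time `n`. -/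
def firstExit {d : ℕ} (ρ c : Fin d → ℝ) (a : ℝ) (n : ℕ) : Set (ℕ → Fin d → ℝ) :=
  {z | (∀ j < n, walk z j ≤ ρ - ((j : ℝ) * a) • c) ∧ ¬ walk z n ≤ ρ - ((n : ℝ) * a) • c}

section

variable {d : ℕ}

theorem walk_add (z : ℕ → Fin d → ℝ) (n m : ℕ) :
    walk z (n + m) = walk z n + walk (fun i => z (n + i)) m :=
  Finset.sum_range_add _ _ _

theorem walk_succ (z : ℕ → Fin d → ℝ) (n : ℕ) : walk z (n + 1) = walk z n + z n :=
  Finset.sum_range_succ _ _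

@[simp]
theorem walk_zero (z : ℕ → Fin d → ℝ) : walk z 0 = 0 := rfl

theorem walk_truncateSeq (z : ℕ → Fin d → ℝ) {n j : ℕ} (h : j ≤ n) :
    walk (truncateSeq n z) j = walk z j :=
  Finset.sum_congr rfl fun _ hi => if_pos ((Finset.mem_range.1 hi).trans_le h)

@[fun_prop]
theorem measurable_walk (n : ℕ) : Measurable fun z : ℕ → Fin d → ℝ => walk z n := by
  unfold walk
  fun_prop

theorem lt_maxWalk_iff {g : (Fin d → ℝ) → ℝ} {N : ℕ} {z : ℕ → Fin d → ℝ} {u : ℝ} :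
    u < maxWalk g N z ↔ ∃ n ≤ N, u < g (walk z n) := by
  simp [maxWalk, Finset.lt_sup'_iff]

theorem le_maxWalk (g : (Fin d → ℝ) → ℝ) {N n : ℕ} (h : n ≤ N) (z : ℕ → Fin d → ℝ) :
    g (walk z n) ≤ maxWalk g N z :=
  Finset.le_sup' (fun n => g (walk z n)) (Finset.mem_range.2 (Nat.lt_succ_of_le h))

theorem measurable_maxWalk {g : (Fin d → ℝ) → ℝ} (hg : Measurable g) (N : ℕ) :
    Measurable (maxWalk g N) := by
  unfold maxWalk
  exact Finset.measurable_range_sup'' fun n _ => hg.comp (measurable_walk n)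

theorem measurableSet_firstExit (ρ c : Fin d → ℝ) (a : ℝ) (n : ℕ) :
    MeasurableSet (firstExit ρ c a n) := by
  have h : ∀ j, MeasurableSet {z : ℕ → Fin d → ℝ | walk z j ≤ ρ - ((j : ℝ) * a) • c} := fun j =>
    measurableSet_le (measurable_walk j) measurable_const
  have : firstExit ρ c a n = (⋂ j ∈ Finset.range n, {z | walk z j ≤ ρ - ((j : ℝ) * a) • c}) ∩
      {z | walk z n ≤ ρ - ((n : ℝ) * a) • c}ᶜ := by
    ext z
    simp [firstExit]
  rw [this]
  exact (Finset.measurableSet_biInter _ fun j _ => h j).inter (h n).compl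

theorem truncateSeq_mem_firstExit {ρ c : Fin d → ℝ} {a : ℝ} {n : ℕ} {z : ℕ → Fin d → ℝ} :
    truncateSeq n z ∈ firstExit ρ c a n ↔ z ∈ firstExit ρ c a n := by
  simp only [firstExit, mem_ofPred_eq, walk_truncateSeq z le_rfl]
  refine and_congr_left fun _ => forall₂_congr fun j hj => ?_
  rw [walk_truncateSeq z hj.le]

theorem pairwise_disjoint_firstExit (ρ c : Fin d → ℝ) (a : ℝ) :
    Pairwise (Function.onFun Disjoint (firstExit ρ c a)) := by
  exact (pairwise_disjoint_on _).2 fun m n hmn =>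
    disjoint_left.2 fun z hm hn => hm.2 (hn.1 m hmn)

/-- If the walk exceeds level `u`, it first exits below the line, and then makes up for the
missing height. -/
theorem exists_firstExit {g : (Fin d → ℝ) → ℝ} (hg : IsMonotoneSubadditive g) {ρ c : Fin d → ℝ}
    (hρ : 0 ≤ ρ) (hc : 0 ≤ c) {a : ℝ} (ha : 0 ≤ a) {u : ℝ} (hu : g ρ ≤ u) {N : ℕ}
    {z : ℕ → Fin d → ℝ} (h : ∃ n ≤ N + 1, u < g (walk z n)) :
    ∃ n, z ∈ firstExit ρ c a n ∧ u < g (walk z n) + maxWalk g N fun i => z (n + i) := by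
  classical
  obtain ⟨j, hj, hlt⟩ := h
  have hex : ∃ n, ¬ walk z n ≤ ρ - ((n : ℝ) * a) • c := by
    refine ⟨j, fun hle => ?_⟩
    have h1 : walk z j ≤ ρ := hle.trans (sub_le_self _ (smul_nonneg (by positivity) hc))
    linarith [hg.monotone h1]
  have hnj : Nat.find hex ≤ j := Nat.find_min' hex fun hle => by
    have h1 : walk z j ≤ ρ := hle.trans (sub_le_self _ (smul_nonneg (by positivity) hc))
    linarith [hg.monotone h1]
  -- Since `ρ ≥ 0` there is no exit at time `0`. The exit thus uses up at least one step, leaving at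
  -- most `N` of the `N + 1`.
  have hpos : Nat.find hex ≠ 0 := fun h0 => by
    have := Nat.find_spec hex
    rw [h0] at this
    simp [hρ] at this
  refine ⟨Nat.find hex, ⟨fun i hi => not_not.1 (Nat.find_min hex hi), Nat.find_spec hex⟩, ?_⟩
  set n := Nat.find hex
  obtain ⟨m, rfl⟩ := Nat.exists_eq_add_of_le hnj
  calc u < g (walk z (n + m)) := hlt
    _ ≤ g (walk z n) + g (walk (fun i => z (n + i)) m) := by
      rw [walk_add]
      exact hg.map_add_le _ _
    _ ≤ _ := by
      gcongr
      exact le_maxWalk g (by omega) _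

end

section

variable {Ω : Type*} [MeasurableSpace Ω] {P : Measure Ω} {d : ℕ}
  {Z : ℕ → Ω → Fin d → ℝ} {g : (Fin d → ℝ) → ℝ}

/-- Tail of the height of the walk at its first exit from below the line. -/
noncomputable def exitTail (P : Measure Ω) (Z : ℕ → Ω → Fin d → ℝ) (g : (Fin d → ℝ) → ℝ)
    (ρ c : Fin d → ℝ) (a x : ℝ) : ℝ≥0∞ :=
  ∑' n, P {ω | (fun i => Z i ω) ∈ firstExit ρ c a n ∧ x < g (walk (fun i => Z i ω) n)}

/-- The exit at time `n` and its height depend on the first `n` steps only, and the later steps form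
an independent copy of the walk. -/
theorem measure_exit_and_lt_add [IsProbabilityMeasure P]
    (hZm : ∀ i, Measurable (Z i)) (hZ : iIndepFun Z P)
    (hZid : ∀ i, IdentDistrib (Z i) (Z 0) P P) (hg : Measurable g) (ρ c : Fin d → ℝ) (a u : ℝ)
    (N n : ℕ) :
    P {ω | (fun i => Z i ω) ∈ firstExit ρ c a n ∧
      u < g (walk (fun i => Z i ω) n) + maxWalk g N fun i => Z (n + i) ω} =
    ∫⁻ y, P {ω | (fun i => Z i ω) ∈ firstExit ρ c a n ∧ u - y < g (walk (fun i => Z i ω) n)}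
      ∂(P.map fun ω => maxWalk g N fun i => Z i ω) := by
  have hmax := measurable_maxWalk hg N
  have hA : Measurable fun ω => truncateSeq n fun i => Z i ω :=
    (measurable_truncateSeq n).comp (by fun_prop)
  have hB : Measurable fun ω => maxWalk g N fun i => Z (n + i) ω := hmax.comp (by fun_prop)
  have hind : IndepFun (fun ω => truncateSeq n fun i => Z i ω)
      (fun ω => maxWalk g N fun i => Z (n + i) ω) P :=
    (indepFun_past_future hZm hZ n).comp measurable_id hmax
  have hlaw : P.map (fun ω => maxWalk g N fun i => Z (n + i) ω) =
      P.map fun ω => maxWalk g N fun i => Z i ω := by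
    have := congrArg (Measure.map (maxWalk g N)) (map_shift_eq hZm hZ hZid n)
    rwa [Measure.map_map hmax (by fun_prop), Measure.map_map hmax (by fun_prop)] at this
  set S : Set ((ℕ → Fin d → ℝ) × ℝ) := {q | q.1 ∈ firstExit ρ c a n ∧ u < g (walk q.1 n) + q.2}
  have hS : MeasurableSet S := (measurable_fst (measurableSet_firstExit ρ c a n)).inter
    (measurableSet_lt measurable_const
      ((hg.comp ((measurable_walk n).comp measurable_fst)).add measurable_snd))
  have h1 : {ω | (fun i => Z i ω) ∈ firstExit ρ c a n ∧
      u < g (walk (fun i => Z i ω) n) + maxWalk g N fun i => Z (n + i) ω} =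
      (fun ω => (truncateSeq n fun i => Z i ω, maxWalk g N fun i => Z (n + i) ω)) ⁻¹' S := by
    ext ω
    simp only [S, mem_preimage, mem_ofPred_eq, truncateSeq_mem_firstExit,
      walk_truncateSeq _ le_rfl]
  have : IsProbabilityMeasure (P.map fun ω => truncateSeq n fun i => Z i ω) :=
    Measure.isProbabilityMeasure_map hA.aemeasurable
  rw [h1, ← Measure.map_apply (hA.prodMk hB) hS,
    hind.map_prod_eq_prod_map_map hA.aemeasurable hB.aemeasurable,
    Measure.prod_apply_symm hS, hlaw]
  refine lintegral_congr fun y => ?_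
  rw [Measure.map_apply hA (measurable_prodMk_right hS)]
  congr 1
  ext ω
  simp only [S, mem_preimage, mem_ofPred_eq, truncateSeq_mem_firstExit, walk_truncateSeq _ le_rfl,
    sub_lt_iff_lt_add]

/-- The renewal inequality: a union bound over the exit time. It passes from horizon `N` to `N + 1`,
so it can be used by induction. -/
theorem measure_max_le_lintegral_exitTail [IsProbabilityMeasure P]
    (hZm : ∀ i, Measurable (Z i)) (hZ : iIndepFun Z P)
    (hZid : ∀ i, IdentDistrib (Z i) (Z 0) P P) (hg : IsMonotoneSubadditive g) {ρ c : Fin d → ℝ}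
    (hρ : 0 ≤ ρ) (hc : 0 ≤ c) {a : ℝ} (ha : 0 ≤ a) {u : ℝ} (hu : g ρ ≤ u) (N : ℕ) :
    P {ω | ∃ n ≤ N + 1, u < g (walk (fun i => Z i ω) n)} ≤
      ∫⁻ y, exitTail P Z g ρ c a (u - y) ∂(P.map fun ω => maxWalk g N fun i => Z i ω) := by
  calc _ ≤ P (⋃ n, {ω | (fun i => Z i ω) ∈ firstExit ρ c a n ∧
        u < g (walk (fun i => Z i ω) n) + maxWalk g N fun i => Z (n + i) ω}) :=
        measure_mono fun ω hω => mem_iUnion.2 (exists_firstExit hg hρ hc ha hu hω)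
    _ ≤ ∑' n, P {ω | (fun i => Z i ω) ∈ firstExit ρ c a n ∧
        u < g (walk (fun i => Z i ω) n) + maxWalk g N fun i => Z (n + i) ω} := measure_iUnion_le _
    _ = _ := by
      simp only [exitTail]
      rw [lintegral_tsum]
      · exact tsum_congr fun n =>
          measure_exit_and_lt_add hZm hZ hZid hg.continuous.measurable ρ c a u N n
      · intro n
        refine (Monotone.measurable fun x y hxy => measure_mono fun ω hω => ?_).aemeasurable
        exact ⟨hω.1, lt_of_le_of_lt (by linarith) hω.2⟩

/-- The exit events at different times are disjoint, so their total mass is at most the probability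
of ever leaving. -/
theorem exitTail_le_measure (hZm : ∀ i, Measurable (Z i)) (ρ c : Fin d → ℝ) (a x : ℝ) :
    exitTail P Z g ρ c a x ≤
      P {ω | ∀ n : ℕ, walk (fun i => Z i ω) n ≤ ρ - ((n : ℝ) * a) • c}ᶜ := by
  have hm : Measurable fun ω i => Z i ω := by fun_prop
  calc _ ≤ ∑' n, P ((fun ω i => Z i ω) ⁻¹' firstExit ρ c a n) :=
        ENNReal.tsum_le_tsum fun n => measure_mono fun ω hω => hω.1
    _ = P (⋃ n, (fun ω i => Z i ω) ⁻¹' firstExit ρ c a n) :=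
        (measure_iUnion (fun m n hmn => (pairwise_disjoint_firstExit ρ c a hmn).preimage _)
          fun n => hm (measurableSet_firstExit ρ c a n)).symm
    _ ≤ _ := measure_mono <| iUnion_subset fun n ω hω =>
        fun hall : ∀ n : ℕ, walk (fun i => Z i ω) n ≤ ρ - ((n : ℝ) * a) • c => hω.2 (hall n)

/-- Just before the exit the walk is below the line, and `Z ≤ X`. Hence the claim at the exit must
itself satisfy `x - g ρ < g (X_n - n a c)`. Replacing the sum over `n` by an integral costs one mesh
width, whence `g (a • c)`. -/
theorem mul_exitTail_le_functionalTail {X : ℕ → Ω → Fin d → ℝ} (hXm : ∀ i, Measurable (X i))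
    (hXid : ∀ i, IdentDistrib (X i) (X 0) P P) (hZX : ∀ᵐ ω ∂P, ∀ i, Z i ω ≤ X i ω)
    (hg : IsMonotoneSubadditive g) {ρ c : Fin d → ℝ} (hρ : 0 ≤ ρ) (hc : 0 ≤ c) {a : ℝ}
    (ha : 0 < a) (x : ℝ) :
    ENNReal.ofReal a * exitTail P Z g ρ c a x ≤
      functionalTail (P.map (X 0)) c g (x - (g ρ + g (a • c))) := by
  have hmeas : ∀ (y : ℝ) (e : Fin d → ℝ), MeasurableSet {q | y < g (q - e)} := fun y e =>
    measurableSet_lt measurable_const (hg.continuous.measurable.comp (by fun_prop))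
  have h0 : P {ω | (fun i => Z i ω) ∈ firstExit ρ c a 0 ∧ x < g (walk (fun i => Z i ω) 0)} = 0 := by
    convert measure_empty (μ := P)
    ext ω
    simp [firstExit, hρ]
  have hstep : ∀ n : ℕ, P {ω | (fun i => Z i ω) ∈ firstExit ρ c a (n + 1) ∧
      x < g (walk (fun i => Z i ω) (n + 1))} ≤
      P.map (X 0) {q | x - g ρ < g (q - ((n : ℝ) * a) • c)} := fun n => by
    rw [← (hXid n).map_eq, Measure.map_apply (hXm n) (hmeas _ _)]
    refine measure_mono_ae ?_
    filter_upwards [hZX] with ω hω hmem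
    have h1 := hmem.1.1 n n.lt_succ_self
    have h2 := hmem.2
    rw [walk_succ] at h2
    have h3 : walk (fun i => Z i ω) n + Z n ω ≤ ρ + (X n ω - ((n : ℝ) * a) • c) := by
      refine (add_le_add h1 (hω n)).trans_eq ?_
      abel
    change x - g ρ < g (X n ω - ((n : ℝ) * a) • c)
    linarith [hg.monotone h3, hg.map_add_le ρ (X n ω - ((n : ℝ) * a) • c)]
  have hsum : exitTail P Z g ρ c a x ≤
      ∑' n : ℕ, P.map (X 0) {q | x - g ρ < g (q - ((n : ℝ) * a) • c)} := by
    rw [exitTail, tsum_eq_zero_add' ENNReal.summable, h0, zero_add]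
    exact ENNReal.tsum_le_tsum hstep
  refine (mul_le_mul_right hsum _).trans (mul_tsum_le_lintegral_Ioi ha fun n v hv => ?_)
  refine measure_mono fun q (hq : x - g ρ < _) => ?_
  have h1 : q - ((n : ℝ) * a) • c ≤ (q - v • c) + a • c := by
    have : q - ((n : ℝ) * a) • c = (q - ((n + 1 : ℝ) * a) • c) + a • c := by
      rw [add_mul, one_mul, add_smul]
      abel
    rw [this]
    exact add_le_add (sub_le_sub_left (smul_le_smul_of_nonneg_right hv.2 hc) _) le_rfl
  change x - (g ρ + g (a • c)) < g (q - v • c)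
  linarith [hg.monotone h1, hg.map_add_le (q - v • c) (a • c)]

end

/-! ### The upper bound. -/

/-- Commutativity of convolution, with `ν` restricted to `(t, ∞)`. It exchanges the law of the
maximum with `ν`, giving the inequality the form used in the renewal lemmas. -/
theorem setLIntegral_tail_le (μ ν : Measure ℝ) [SFinite μ] [SFinite ν] (t u : ℝ) :
    ∫⁻ y in Iic (u - t), ν (Ioi (u - y)) ∂μ ≤ ∫⁻ x in Ioi t, μ (Ioi (u - x)) ∂ν := by
  calc _ = ∫⁻ y in Iic (u - t), (ν.restrict (Ioi t)) (Ioi (u - y)) ∂μ :=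
        setLIntegral_congr_fun measurableSet_Iic fun y (hy : y ≤ u - t) => by
          simp only [Measure.restrict_apply measurableSet_Ioi]
          rw [inter_eq_left.2 (Ioi_subset_Ioi (by linarith))]
    _ ≤ ∫⁻ y, (ν.restrict (Ioi t)) (Ioi (u - y)) ∂μ := setLIntegral_le_lintegral _ _
    _ = _ := by rw [← conv_Ioi, Measure.conv_comm, conv_Ioi]

section

variable {Ω : Type*} [MeasurableSpace Ω] {P : Measure Ω} [IsProbabilityMeasure P] {d : ℕ}

/-- Upper bound for the probability that a random walk with negative drift ever exceeds a high
level, as measured by `g`. -/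
theorem eventually_measure_exceed_le {X Z : ℕ → Ω → Fin d → ℝ} {g : (Fin d → ℝ) → ℝ}
    (hXm : ∀ i, Measurable (X i)) (hXid : ∀ i, IdentDistrib (X i) (X 0) P P)
    (hZm : ∀ i, Measurable (Z i)) (hZ : iIndepFun Z P)
    (hZid : ∀ i, IdentDistrib (Z i) (Z 0) P P) (hZint : Integrable (Z 0) P)
    (hZX : ∀ᵐ ω ∂P, ∀ i, Z i ω ≤ X i ω) {c : Fin d → ℝ} (hc : c = -∫ ω, Z 0 ω ∂P)
    (hcpos : ∀ j, 0 < c j) (hg : IsMonotoneSubadditive g) {ν : Measure ℝ}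
    (hν : IsSubexponential ν) {θ : ℝ} (hθ : 0 < θ)
    (hH : ∀ u, 0 < u → functionalTail (P.map (X 0)) c g u = ENNReal.ofReal θ * ν (Ioi u))
    {b : ℝ} (hb : θ < b) :
    ∀ᶠ u in atTop, P {ω | ∃ n, u < g (walk (fun i => Z i ω) n)} ≤
      ENNReal.ofReal b * ν (Ioi u) := by
  have := hν.isProbabilityMeasure
  have hc0 : 0 ≤ c := fun j => (hcpos j).le
  -- Three losses, each tending to `1` with `s`: `θ / (1 - s)` from the mesh `1 - s`, the next
  -- factor from absorbing a fixed shift of the tail, and the last from `1 / (1 - 4γ)` with `γ = s /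
  -- 4`.
  obtain ⟨s, hs0, hs2, hsb⟩ : ∃ s : ℝ, 0 < s ∧ s ≤ 1 / 2 ∧
      θ / (1 - s) * (1 - s)⁻¹ / (1 - s) < b := by
    have hcont : ContinuousAt (fun s : ℝ => θ / (1 - s) * (1 - s)⁻¹ / (1 - s)) 0 := by
      fun_prop (disch := norm_num)
    have h1 : ∀ᶠ s : ℝ in 𝓝[>] 0, θ / (1 - s) * (1 - s)⁻¹ / (1 - s) < b :=
      (hcont.eventually_lt continuousAt_const (by simpa using hb)).filter_mono nhdsWithin_le_nhds
    have h2 : ∀ᶠ s : ℝ in 𝓝[>] 0, s ≤ 1 / 2 :=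
      (eventually_le_nhds (by norm_num)).filter_mono nhdsWithin_le_nhds
    obtain ⟨s, ⟨h1, h2⟩, h3⟩ := ((h1.and h2).and self_mem_nhdsWithin).exists
    exact ⟨s, h3, h2, h1⟩
  set a := 1 - s with ha
  have hapos : 0 < a := by linarith
  set α := θ / a * a⁻¹ with hα
  have hαpos : 0 < α := by positivity
  set γ := s / 4 with hγ
  have hγpos : 0 < γ := by positivity
  obtain ⟨r, hr⟩ := exists_walk_envelope hZm hZ hZid hZint hc hcpos hs0 hγpos
  set ρ : Fin d → ℝ := fun _ => (r : ℝ) with hρ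
  have hρ0 : 0 ≤ ρ := fun _ => Nat.cast_nonneg r
  have hexit1 : ∀ x, exitTail P Z g ρ c a x ≤ ENNReal.ofReal γ := fun x =>
    (exitTail_le_measure hZm ρ c a x).trans <| (measure_mono <| compl_subset_compl.2
      fun ω hω n => (hω n).1).trans hr
  have hexit2 : ∀ᶠ x in atTop, exitTail P Z g ρ c a x ≤ ENNReal.ofReal α * ν (Ioi x) := by
    filter_upwards [eventually_gt_atTop (g ρ + g (a • c)),
      hν.eventually_tail_sub_le (g ρ + g (a • c)) (one_lt_inv_iff₀.2 ⟨hapos, by linarith⟩)]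
      with x h1 h2
    have h3 := mul_exitTail_le_functionalTail hXm hXid hZX hg hρ0 hc0 hapos x
    rw [hH _ (by linarith)] at h3
    have h4 : exitTail P Z g ρ c a x ≤
        ENNReal.ofReal a⁻¹ * (ENNReal.ofReal θ * ν (Ioi (x - (g ρ + g (a • c))))) := by
      rw [ENNReal.ofReal_inv_of_pos hapos, ← ENNReal.mul_le_iff_le_inv]
      · exact h3
      · exact (ENNReal.ofReal_pos.2 hapos).ne'
      · exact ENNReal.ofReal_ne_top
    refine h4.trans ?_
    calc _ ≤ ENNReal.ofReal a⁻¹ * (ENNReal.ofReal θ * (ENNReal.ofReal a⁻¹ * ν (Ioi x))) := by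
          gcongr
      _ = _ := by
          rw [hα, ENNReal.ofReal_mul (by positivity), div_eq_mul_inv, ENNReal.ofReal_mul hθ.le]
          ring
  have hsmall : ∀ᶠ x in atTop, ENNReal.ofReal α * ν (Ioi x) ≤ ENNReal.ofReal γ := by
    have h1 := ENNReal.Tendsto.const_mul (a := ENNReal.ofReal α) hν.tendsto_tail
      (Or.inr ENNReal.ofReal_ne_top)
    rw [mul_zero] at h1
    exact h1.eventually_le_const (ENNReal.ofReal_pos.2 hγpos)
  obtain ⟨x₀, hx₀⟩ := eventually_atTop.1 (hexit2.and hsmall)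
  set w : ℕ → ℝ → ℝ≥0∞ := fun N u => P {ω | ∃ n ≤ N, u < g (walk (fun i => Z i ω) n)} with hw
  have hmaxm : ∀ N, Measurable fun ω => maxWalk g N fun i => Z i ω := fun N =>
    (measurable_maxWalk hg.continuous.measurable N).comp (by fun_prop)
  have hwmap : ∀ N u, (P.map fun ω => maxWalk g N fun i => Z i ω) (Ioi u) = w N u := fun N u => by
    rw [Measure.map_apply (hmaxm N) measurableSet_Ioi]
    congr 1
    ext ω
    exact lt_maxWalk_iff
  have hmono : ∀ u, Monotone fun N => w N u := fun u M N hMN =>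
    measure_mono fun ω ⟨n, hn, h⟩ => ⟨n, hn.trans hMN, h⟩
  have hsup : ∀ u, P {ω | ∃ n, u < g (walk (fun i => Z i ω) n)} = ⨆ N, w N u := fun u => by
    rw [hw, ← Monotone.measure_iUnion (s := fun N => {ω | ∃ n ≤ N, u < g (walk (fun i => Z i ω) n)})
      fun M N hMN ω ⟨n, hn, h⟩ => ⟨n, hn.trans hMN, h⟩]
    congr 1
    ext ω
    simp only [mem_ofPred_eq, mem_iUnion]
    exact ⟨fun ⟨n, h⟩ => ⟨n, n, le_rfl, h⟩, fun ⟨_, n, _, h⟩ => ⟨n, h⟩⟩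
  simp only [hsup]
  refine hν.eventually_iSup_le (k := g ρ) (x₀ := x₀) (fun N u => prob_le_one) hmono
    (fun u hu => ?_) hαpos hγpos (by linarith) (hx₀ x₀ le_rfl).2 (fun N u hu => ?_)
    (by rwa [hγ, mul_div_cancel₀ _ (by norm_num : (4 : ℝ) ≠ 0)])
  · convert measure_empty (μ := P)
    ext ω
    simp [hg.map_zero, hu]
  · refine (measure_max_le_lintegral_exitTail hZm hZ hZid hg hρ0 hc0 hapos.le hu N).trans ?_
    set ω := P.map fun ω => maxWalk g N fun i => Z i ω with hω
    have : IsProbabilityMeasure ω := Measure.isProbabilityMeasure_map (hmaxm N).aemeasurable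
    -- If the restarted walk reaches above `u - x₀`, the exit height is bounded only through its
    -- total mass `γ`; otherwise the height exceeds at least `x₀` and its tail bound applies.
    rw [← lintegral_add_compl _ (measurableSet_Ioi (a := u - x₀)), compl_Ioi]
    refine add_le_add ?_ ?_
    · calc _ ≤ ∫⁻ _ in Ioi (u - x₀), ENNReal.ofReal γ ∂ω := lintegral_mono fun y => hexit1 _
        _ = _ := by rw [setLIntegral_const, hwmap]
    · calc _ ≤ ∫⁻ y in Iic (u - x₀), ENNReal.ofReal α * ν (Ioi (u - y)) ∂ω :=
            setLIntegral_mono' measurableSet_Iic fun y (hy : y ≤ u - x₀) =>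
              (hx₀ _ (by linarith)).1
        _ = ENNReal.ofReal α * ∫⁻ y in Iic (u - x₀), ν (Ioi (u - y)) ∂ω :=
            lintegral_const_mul _ (measurable_tail_sub ν u)
        _ ≤ ENNReal.ofReal α * ∫⁻ x in Ioi x₀, ω (Ioi (u - x)) ∂ν :=
            mul_le_mul_right (setLIntegral_tail_le ω ν x₀ u) _
        _ = _ := congrArg _ (lintegral_congr fun x => hwmap N _)

end

/-! ### The lower bound. -/

section

variable {Ω : Type*} [MeasurableSpace Ω] {P : Measure Ω}

theorem ofReal_one_sub_le_measure [IsProbabilityMeasure P] {S : Set Ω} {t : ℝ} (ht : 0 ≤ t) (h : P Sᶜ ≤ ENNReal.ofReal t) :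
    ENNReal.ofReal (1 - t) ≤ P S := by
  rw [ENNReal.ofReal_sub _ ht, ENNReal.ofReal_one, tsub_le_iff_right]
  calc (1 : ℝ≥0∞) = P (S ∪ Sᶜ) := by rw [union_compl_self, measure_univ]
    _ ≤ P S + P Sᶜ := measure_union_le _ _
    _ ≤ _ := by gcongr

variable {d : ℕ} {X : ℕ → Ω → Fin d → ℝ} {Y : ℕ → Ω → ℝ} {g : (Fin d → ℝ) → ℝ}

/-- The walk stays below level `u` up to time `n`, where it is above `e`, and a large jump
follows immediately. -/
theorem measure_late_jump_eq (hXm : ∀ i, Measurable (X i)) (hYm : ∀ i, Measurable (Y i))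
    (hV : iIndepFun (fun i ω => (X i ω, Y i ω)) P) (hXY : ∀ i, IndepFun (X i) (Y i) P)
    (hXid : ∀ i, IdentDistrib (X i) (X 0) P P) (hYid : ∀ i, IdentDistrib (Y i) (Y 0) P P)
    (hg : Measurable g) (p e f : Fin d → ℝ) (M u x : ℝ) (n : ℕ) :
    P {ω | ((∀ j ≤ n, g (walk (fun i => X i ω - Y i ω • p) j) ≤ u) ∧
        e ≤ walk (fun i => X i ω - Y i ω • p) n) ∧ x < g (X n ω - f) ∧ Y n ω ≤ M} =
      P {ω | (∀ j ≤ n, g (walk (fun i => X i ω - Y i ω • p) j) ≤ u) ∧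
        e ≤ walk (fun i => X i ω - Y i ω • p) n} *
      (P.map (X 0) {q | x < g (q - f)} * P {ω | Y 0 ω ≤ M}) := by
  have hVm : ∀ i, Measurable fun ω => (X i ω, Y i ω) := fun i => (hXm i).prodMk (hYm i)
  have hind := (indepFun_past_future hVm hV n).comp measurable_id (measurable_pi_apply 0)
  set A : Set (ℕ → (Fin d → ℝ) × ℝ) :=
    {z | (∀ j ≤ n, g (walk (fun i => (z i).1 - (z i).2 • p) j) ≤ u) ∧
      e ≤ walk (fun i => (z i).1 - (z i).2 • p) n}
  have hwalk : ∀ j, Measurable fun z : ℕ → (Fin d → ℝ) × ℝ =>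
      walk (fun i => (z i).1 - (z i).2 • p) j := fun j => (measurable_walk j).comp (by fun_prop)
  have hA : MeasurableSet A := by
    refine MeasurableSet.inter (s₁ := {z | ∀ j ≤ n, g (walk (fun i => (z i).1 - (z i).2 • p) j) ≤ u})
      ?_ (measurableSet_le measurable_const (hwalk n))
    simp only [ofPred_forall]
    exact MeasurableSet.iInter fun j => MeasurableSet.iInter fun _ =>
      measurableSet_le (hg.comp (hwalk j)) measurable_const
  have hC : MeasurableSet {q : Fin d → ℝ | x < g (q - f)} :=
    measurableSet_lt measurable_const (hg.comp (by fun_prop))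
  have hD : MeasurableSet {y : ℝ | y ≤ M} := measurableSet_Iic
  have htrunc : ∀ (z : ℕ → (Fin d → ℝ) × ℝ), ∀ j ≤ n,
      walk (fun i => (truncateSeq n z i).1 - (truncateSeq n z i).2 • p) j =
        walk (fun i => (z i).1 - (z i).2 • p) j := fun z j hj =>
    Finset.sum_congr rfl fun i hi => by
      simp only [truncateSeq, if_pos ((Finset.mem_range.1 hi).trans_le hj)]
  have hpast : {ω | (∀ j ≤ n, g (walk (fun i => X i ω - Y i ω • p) j) ≤ u) ∧
        e ≤ walk (fun i => X i ω - Y i ω • p) n} =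
      (fun ω => truncateSeq n fun i => (X i ω, Y i ω)) ⁻¹' A := by
    ext ω
    simp only [A, mem_preimage, mem_ofPred_eq, htrunc _ n le_rfl]
    refine and_congr_left fun _ => forall₂_congr fun j hj => ?_
    rw [htrunc _ j hj]
  have h1 := hind.measure_inter_preimage_eq_mul A
    ({q : Fin d → ℝ | x < g (q - f)} ×ˢ {y : ℝ | y ≤ M}) hA (hC.prod hD)
  have h2 := (hXY n).measure_inter_preimage_eq_mul _ _ hC hD
  rw [← Measure.map_apply (hXm n) hC, ← Measure.map_apply (hYm n) hD, (hXid n).map_eq,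
    (hYid n).map_eq, Measure.map_apply (hYm 0) hD] at h2
  change P ({ω | (∀ j ≤ n, g (walk (fun i => X i ω - Y i ω • p) j) ≤ u) ∧
    e ≤ walk (fun i => X i ω - Y i ω • p) n} ∩ _) = _
  rw [hpast]
  exact h1.trans (congrArg _ h2)

/-- Lower bound for the probability that the random walk ever exceeds a high level. -/
theorem eventually_le_measure_exceed [IsProbabilityMeasure P]
    (hXm : ∀ i, Measurable (X i)) (hYm : ∀ i, Measurable (Y i))
    (hV : iIndepFun (fun i ω => (X i ω, Y i ω)) P) (hXY : ∀ i, IndepFun (X i) (Y i) P)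
    (hXid : ∀ i, IdentDistrib (X i) (X 0) P P) (hYid : ∀ i, IdentDistrib (Y i) (Y 0) P P)
    {p : Fin d → ℝ} (hp : 0 ≤ p)
    (hZ : iIndepFun (fun i ω => X i ω - Y i ω • p) P)
    (hZid : ∀ i, IdentDistrib (fun ω => X i ω - Y i ω • p) (fun ω => X 0 ω - Y 0 ω • p) P P)
    (hZint : Integrable (fun ω => X 0 ω - Y 0 ω • p) P)
    {c : Fin d → ℝ} (hc : c = -∫ ω, (X 0 ω - Y 0 ω • p) ∂P)
    (hcpos : ∀ j, 0 < c j) (hg : IsMonotoneSubadditive g) {ν : Measure ℝ}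
    (hν : IsSubexponential ν) {θ : ℝ} (hθ : 0 < θ)
    (hH : ∀ u, 0 < u → functionalTail (P.map (X 0)) c g u = ENNReal.ofReal θ * ν (Ioi u))
    (hψ : Tendsto (fun u => P {ω | ∃ n, u < g (walk (fun i => X i ω - Y i ω • p) n)}) atTop (𝓝 0))
    {b : ℝ} (hb : b < θ) :
    ∀ᶠ u in atTop, ENNReal.ofReal b * ν (Ioi u) ≤
      P {ω | ∃ n, u < g (walk (fun i => X i ω - Y i ω • p) n)} := by
  have hc0 : 0 ≤ c := fun j => (hcpos j).le
  have hgm := hg.continuous.measurable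
  -- The factors come, in order, from the past staying in its region, from `Y n ≤ M`, and from two
  -- losses of `1 + s`: the mesh of the sum and the shift of the tail by `K`.
  obtain ⟨s, hs0, hs2, hsb⟩ : ∃ s : ℝ, 0 < s ∧ s ≤ 1 / 2 ∧
      b < (1 - (s + s)) * (1 - s) * ((1 + s)⁻¹ * (θ * (1 + s)⁻¹)) := by
    have hcont : ContinuousAt
        (fun s : ℝ => (1 - (s + s)) * (1 - s) * ((1 + s)⁻¹ * (θ * (1 + s)⁻¹))) 0 := by
      fun_prop (disch := norm_num)
    have h1 : ∀ᶠ s : ℝ in 𝓝[>] 0, b < (1 - (s + s)) * (1 - s) * ((1 + s)⁻¹ * (θ * (1 + s)⁻¹)) :=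
      (continuousAt_const.eventually_lt hcont (by simpa using hb)).filter_mono nhdsWithin_le_nhds
    have h2 : ∀ᶠ s : ℝ in 𝓝[>] 0, s ≤ 1 / 2 :=
      (eventually_le_nhds (by norm_num)).filter_mono nhdsWithin_le_nhds
    obtain ⟨s, ⟨h1, h2⟩, h3⟩ := ((h1.and h2).and self_mem_nhdsWithin).exists
    exact ⟨s, h3, h2, h1⟩
  obtain ⟨r, hr⟩ := exists_walk_envelope (fun i => (hXm i).sub ((hYm i).smul_const p)) hZ hZid
    hZint hc hcpos hs0 hs0
  set e : Fin d → ℝ := fun _ => (r : ℝ)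
  obtain ⟨M, hM⟩ : ∃ M : ℕ, P {ω | Y 0 ω ≤ M}ᶜ ≤ ENNReal.ofReal s :=
    exists_measure_compl_le (S := fun M : ℕ => {ω | Y 0 ω ≤ M})
      (fun m n hmn ω (hω : Y 0 ω ≤ m) => hω.trans (Nat.cast_le.2 hmn))
      (fun m => measurableSet_le (hYm 0) measurable_const) (ae_of_all _ fun ω => exists_nat_ge (Y 0 ω)) hs0
  have hM' := ofReal_one_sub_le_measure hs0.le hM
  -- By subadditivity, `K` bounds what the envelope offset `e` and the premium of one interarrival
  -- time, at most `M • p`, can take from the jump.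
  set K := g e + g ((M : ℝ) • p)
  have htail : ∀ᶠ u in atTop, ν (Ioi u) ≤ ENNReal.ofReal (1 + s) * ν (Ioi (u + K)) := by
    have := (tendsto_atTop_add_const_right atTop K tendsto_id).eventually
      (hν.eventually_tail_sub_le K (show 1 < 1 + s by linarith))
    simpa using this
  filter_upwards [htail, hψ.eventually_le_const (ENNReal.ofReal_pos.2 hs0),
    eventually_gt_atTop (-K)] with u h1 h2 h3
  set S : ℕ → Ω → Fin d → ℝ := fun n ω => walk (fun i => X i ω - Y i ω • p) n with hS
  have hA : ∀ n : ℕ, ENNReal.ofReal (1 - (s + s)) ≤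
      P {ω | (∀ j ≤ n, g (S j ω) ≤ u) ∧ -e - ((n : ℝ) * (1 + s)) • c ≤ S n ω} := fun n => by
    refine ofReal_one_sub_le_measure (by positivity) ?_
    rw [ENNReal.ofReal_add hs0.le hs0.le]
    refine le_trans (measure_mono fun ω hω => ?_) ((measure_union_le _ _).trans (add_le_add h2 hr))
    by_contra hn
    simp only [mem_union, not_or, mem_compl_iff, not_not, mem_ofPred_eq, not_exists, not_lt] at hn
    exact hω ⟨fun j _ => hn.1 j, (hn.2 n).2⟩
  set B : ℕ → Set Ω := fun n => {ω | ((∀ j ≤ n, g (S j ω) ≤ u) ∧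
    -e - ((n : ℝ) * (1 + s)) • c ≤ S n ω) ∧ u + K < g (X n ω - ((n : ℝ) * (1 + s)) • c) ∧
    Y n ω ≤ M}
  have hexceed : ∀ n, ∀ ω ∈ B n, u < g (S (n + 1) ω) := by
    rintro n ω ⟨⟨-, h4⟩, h5, h6⟩
    have h7 : X n ω - ((n : ℝ) * (1 + s)) • c ≤ S (n + 1) ω + (e + (M : ℝ) • p) := by
      have h8 : Y n ω • p ≤ (M : ℝ) • p := smul_le_smul_of_nonneg_right h6 hp
      have h9 : S (n + 1) ω = S n ω + (X n ω - Y n ω • p) := walk_succ _ _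
      rw [h9]
      intro j
      have h4j := h4 j
      have h8j := h8 j
      simp only [Pi.sub_apply, Pi.neg_apply, Pi.add_apply] at h4j ⊢
      linarith
    have := hg.monotone h7
    linarith [hg.map_add_le (S (n + 1) ω) (e + (M : ℝ) • p), hg.map_add_le e ((M : ℝ) • p)]
  have hSm : ∀ n, Measurable (S n) := fun n => by
    refine (measurable_walk n).comp (measurable_pi_iff.2 fun i => ?_)
    exact (hXm i).sub ((hYm i).smul_const p)
  have hBm : ∀ n, MeasurableSet (B n) := fun n => by
    refine MeasurableSet.inter (MeasurableSet.inter (s₁ := {ω | ∀ j ≤ n, g (S j ω) ≤ u}) ?_ (measurableSet_le measurable_const (hSm n)))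
      ((measurableSet_lt measurable_const (hgm.comp ((hXm n).sub measurable_const))).inter
        (measurableSet_le (hYm n) measurable_const))
    simp only [ofPred_forall]
    exact MeasurableSet.iInter fun j => MeasurableSet.iInter fun _ =>
      measurableSet_le (hgm.comp (hSm j)) measurable_const
  -- `B m` forces the walk above `u` at time `m + 1`, while `B n` forbids this at all times up to
  -- `n`.
  have hdisj : Pairwise (Function.onFun Disjoint B) := (pairwise_disjoint_on _).2 fun m n hmn =>
    disjoint_left.2 fun ω hm hn => not_lt_of_ge (hn.1.1 (m + 1) hmn) (hexceed m ω hm)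
  have hB : ∀ n : ℕ, ENNReal.ofReal ((1 - (s + s)) * (1 - s)) *
      P.map (X 0) {q | u + K < g (q - ((n : ℝ) * (1 + s)) • c)} ≤ P (B n) := fun n => by
    have := measure_late_jump_eq hXm hYm hV hXY hXid hYid hgm p
      (-e - ((n : ℝ) * (1 + s)) • c) (((n : ℝ) * (1 + s)) • c) M u (u + K) n
    refine le_trans ?_ this.ge
    rw [ENNReal.ofReal_mul (by linarith), mul_assoc, mul_comm (ENNReal.ofReal (1 - s))]
    exact mul_le_mul' (hA n) (mul_le_mul' le_rfl hM')
  have hint : functionalTail (P.map (X 0)) c g (u + K) ≤ ENNReal.ofReal (1 + s) *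
      ∑' n : ℕ, P.map (X 0) {q | u + K < g (q - ((n : ℝ) * (1 + s)) • c)} :=
    lintegral_Ioi_le_mul_tsum (by positivity) fun n v hv => hg.antitone_shift hc0 (u + K) hv.1.le
  rw [hH _ (by linarith)] at hint
  have hs1 : ENNReal.ofReal (1 + s)⁻¹ * ENNReal.ofReal (1 + s) = 1 := by
    rw [← ENNReal.ofReal_mul (by positivity), inv_mul_cancel₀ (by positivity), ENNReal.ofReal_one]
  calc ENNReal.ofReal b * ν (Ioi u)
      ≤ ENNReal.ofReal ((1 - (s + s)) * (1 - s) * ((1 + s)⁻¹ * (θ * (1 + s)⁻¹))) *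
          (ENNReal.ofReal (1 + s) * ν (Ioi (u + K))) := by gcongr
    _ = ENNReal.ofReal ((1 - (s + s)) * (1 - s)) * (ENNReal.ofReal (1 + s)⁻¹ *
          (ENNReal.ofReal θ * ν (Ioi (u + K)))) *
          (ENNReal.ofReal (1 + s)⁻¹ * ENNReal.ofReal (1 + s)) := by
        rw [ENNReal.ofReal_mul (mul_nonneg (by linarith) (by linarith)),
          ENNReal.ofReal_mul (p := (1 + s)⁻¹) (by positivity), ENNReal.ofReal_mul hθ.le]
        ring
    _ ≤ ENNReal.ofReal ((1 - (s + s)) * (1 - s)) * (ENNReal.ofReal (1 + s)⁻¹ *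
          (ENNReal.ofReal (1 + s) *
            ∑' n : ℕ, P.map (X 0) {q | u + K < g (q - ((n : ℝ) * (1 + s)) • c)})) := by
        rw [hs1, mul_one]
        gcongr
    _ = ∑' n : ℕ, ENNReal.ofReal ((1 - (s + s)) * (1 - s)) *
          P.map (X 0) {q | u + K < g (q - ((n : ℝ) * (1 + s)) • c)} := by
        rw [← mul_assoc (ENNReal.ofReal (1 + s)⁻¹), hs1, one_mul, ENNReal.tsum_mul_left]
    _ ≤ ∑' n, P (B n) := ENNReal.tsum_le_tsum hB
    _ = P (⋃ n, B n) := (measure_iUnion hdisj hBm).symm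
    _ ≤ _ := measure_mono <| iUnion_subset fun n ω hω =>
        show ∃ m, u < g (S m ω) from ⟨n + 1, hexceed n ω hω⟩

end

/-! ### From continuous time to the embedded walk. -/

section

variable {Ω : Type*} {d : ℕ}

/-- The interarrival times may have infinite mean, so the law of large numbers is applied to their
truncations at `1`. -/
theorem ae_tendsto_arrivalTime [MeasurableSpace Ω] {P : Measure Ω} [IsProbabilityMeasure P]
    {Y : ℕ → Ω → ℝ} (hYm : ∀ i, Measurable (Y i)) (hY : iIndepFun Y P)
    (hYid : ∀ i, IdentDistrib (Y i) (Y 0) P P) (hpos : ∀ᵐ ω ∂P, 0 < Y 0 ω) :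
    ∀ᵐ ω ∂P, Tendsto (fun n => arrivalTime Y n ω) atTop atTop := by
  have hmin : Measurable fun y : ℝ => min y 1 := by fun_prop
  have hint : Integrable (fun ω => min (Y 0 ω) 1) P := by
    refine Integrable.of_bound (hmin.comp (hYm 0)).aestronglyMeasurable 1 ?_
    filter_upwards [hpos] with ω hω
    rw [Real.norm_eq_abs, abs_of_nonneg (by positivity)]
    exact min_le_right _ _
  have hmean : 0 < ∫ ω, min (Y 0 ω) 1 ∂P := by
    rw [integral_pos_iff_support_of_nonneg_ae (hpos.mono fun ω hω => by
      simp only [Pi.zero_apply]; positivity) hint]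
    have h1 : Function.support (fun ω => min (Y 0 ω) 1) =ᵐ[P] univ := by
      rw [eventuallyEq_univ]
      filter_upwards [hpos] with ω hω
      exact (lt_min hω one_pos).ne'
    rw [measure_congr h1, measure_univ]
    exact one_pos
  filter_upwards [strong_law_ae_real (fun i ω => min (Y i ω) 1) hint
    (fun i j hij => (hY.indepFun hij).comp hmin hmin) fun i => (hYid i).comp hmin] with ω hω
  have h1 := hω.pos_mul_atTop hmean tendsto_natCast_atTop_atTop
  refine tendsto_atTop_mono' _ ?_ h1
  filter_upwards [eventually_gt_atTop 0] with n hn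
  rw [div_mul_cancel₀ _ (Nat.cast_pos.2 hn).ne']
  exact Finset.sum_le_sum fun i _ => min_le_left _ _

theorem strictMono_arrivalTime {Y : ℕ → Ω → ℝ} {ω : Ω} (h : ∀ i, 0 < Y i ω) :
    StrictMono fun n => arrivalTime Y n ω :=
  strictMono_nat_of_lt_succ fun n => by
    simp only [arrivalTime, Finset.sum_range_succ]
    linarith [h n]

theorem claimCount_arrivalTime {Y : ℕ → Ω → ℝ} {ω : Ω} (h : ∀ i, 0 < Y i ω) (n : ℕ) :
    claimCount Y (arrivalTime Y n ω) ω = n := by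
  have h1 : {m : ℕ | 1 ≤ m ∧ arrivalTime Y m ω ≤ arrivalTime Y n ω} = Icc 1 n := by
    ext m
    simp only [mem_ofPred_eq, mem_Icc]
    exact and_congr_right fun _ => (strictMono_arrivalTime h).le_iff_le
  rw [claimCount, h1]
  rcases Nat.eq_zero_or_pos n with rfl | hn
  -- The set is empty here, and `sSup ∅ = 0` in `ℕ`.
  · simp
  · exact csSup_Icc hn

theorem arrivalTime_claimCount_le {Y : ℕ → Ω → ℝ} {ω : Ω}
    (h : Tendsto (fun n => arrivalTime Y n ω) atTop atTop) {t : ℝ} (ht : 0 ≤ t) :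
    arrivalTime Y (claimCount Y t ω) ω ≤ t := by
  rcases eq_empty_or_nonempty {n : ℕ | 1 ≤ n ∧ arrivalTime Y n ω ≤ t} with h0 | h0
  · rw [claimCount, h0]
    simpa [arrivalTime] using ht
  · obtain ⟨N, hN⟩ := eventually_atTop.1 (h.eventually_gt_atTop t)
    exact (Nat.sSup_mem h0 ⟨N, fun n hn => by
      by_contra! hlt
      exact not_lt_of_ge hn.2 (hN n hlt.le)⟩).2

theorem mem_smul_surplusSet {b : Fin d → ℝ} {L : Set (Fin d → ℝ)} (hL : IsRuinSet L) {u : ℝ}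
    (hu : 0 < u) {x : Fin d → ℝ} : x ∈ u • surplusSet b L ↔ u • b - x ∈ L := by
  rw [mem_smul_set_iff_inv_smul_mem₀ hu.ne', mem_surplusSet]
  conv_rhs => rw [← hL.smul_eq u hu, mem_smul_set_iff_inv_smul_mem₀ hu.ne', smul_sub,
    inv_smul_smul₀ hu.ne']

/-- Ruin happens if and only if the embedded random walk ever enters `u (b - L)`. -/
theorem exists_riskReserve_mem_iff {X : ℕ → Ω → Fin d → ℝ} {Y : ℕ → Ω → ℝ} {p b : Fin d → ℝ}
    (hp : 0 ≤ p) {L : Set (Fin d → ℝ)} (hL : IsRuinSet L) {u : ℝ} (hu : 0 < u) {ω : Ω}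
    (hpos : ∀ i, 0 < Y i ω) (hlim : Tendsto (fun n => arrivalTime Y n ω) atTop atTop) :
    (∃ t : ℝ, 0 ≤ t ∧ riskReserve X Y p b u t ω ∈ L) ↔
      ∃ n, walk (fun i => X i ω - Y i ω • p) n ∈ u • surplusSet b L := by
  have hwalk : ∀ n, u • b - walk (fun i => X i ω - Y i ω • p) n =
      u • b + arrivalTime Y n ω • p - ∑ i ∈ Finset.range n, X i ω := fun n => by
    rw [walk, Finset.sum_sub_distrib, ← Finset.sum_smul, arrivalTime]
    abel
  simp only [mem_smul_surplusSet hL hu, hwalk]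
  constructor
  · rintro ⟨t, ht, hmem⟩
    -- Between claims the reserve can only grow because `p ≥ 0`. As `L` is decreasing, ruin at time
    -- `t` implies ruin at the last claim time before `t`, or at time `0`.
    refine ⟨claimCount Y t ω, hL.decreasing (sub_le_sub_right (add_le_add_right ?_ _) _) hmem⟩
    exact smul_le_smul_of_nonneg_right (arrivalTime_claimCount_le hlim ht) hp
  · rintro ⟨n, hmem⟩
    refine ⟨arrivalTime Y n ω, Finset.sum_nonneg fun i _ => (hpos i).le, ?_⟩
    rwa [riskReserve, claimCount_arrivalTime hpos]

end

/-! ### Conclusion. -/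

theorem identDistrib_prodMk {Ω α β : Type*} [MeasurableSpace Ω] {P : Measure Ω}
    [IsFiniteMeasure P] [MeasurableSpace α] [MeasurableSpace β] {X X' : Ω → α} {Y Y' : Ω → β}
    (hX : IdentDistrib X X' P P) (hY : IdentDistrib Y Y' P P) (h : IndepFun X Y P)
    (h' : IndepFun X' Y' P) :
    IdentDistrib (fun ω => (X ω, Y ω)) (fun ω => (X' ω, Y' ω)) P P where
  aemeasurable_fst := hX.aemeasurable_fst.prodMk hY.aemeasurable_fst
  aemeasurable_snd := hX.aemeasurable_snd.prodMk hY.aemeasurable_snd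
  map_eq := by
    rw [h.map_prod_eq_prod_map_map hX.aemeasurable_fst hY.aemeasurable_fst,
      h'.map_prod_eq_prod_map_map hX.aemeasurable_snd hY.aemeasurable_snd, hX.map_eq, hY.map_eq]

/-- Sharp two-sided bounds by multiples of a tail determine the limit of the ratio. -/
theorem tendsto_toReal_div_one {ν : Measure ℝ} (hν : IsSubexponential ν) {θ : ℝ} (hθ : 0 < θ)
    {ψ : ℝ → ℝ≥0∞} (hψ : ∀ u, ψ u ≠ ∞)
    (hup : ∀ b, θ < b → ∀ᶠ u in atTop, ψ u ≤ ENNReal.ofReal b * ν (Ioi u))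
    (hlow : ∀ b, b < θ → ∀ᶠ u in atTop, ENNReal.ofReal b * ν (Ioi u) ≤ ψ u) :
    Tendsto (fun u => (ψ u).toReal / (θ * ν.real (Ioi u))) atTop (𝓝 1) := by
  have := hν.isProbabilityMeasure
  have hpos : ∀ u, 0 < ν.real (Ioi u) := fun u =>
    ENNReal.toReal_pos (hν.tail_pos u).ne' (measure_ne_top _ _)
  refine tendsto_order.2 ⟨fun a ha => ?_, fun a ha => ?_⟩
  · filter_upwards [hlow (θ * ((a + 1) / 2)) (by nlinarith)] with u hu
    have h1 := ENNReal.toReal_mono (hψ u) hu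
    rw [ENNReal.toReal_mul, ← measureReal_def] at h1
    have h2 := mul_le_mul_of_nonneg_right
      ((le_max_left (θ * ((a + 1) / 2)) 0).trans_eq ENNReal.toReal_ofReal'.symm) (hpos u).le
    rw [lt_div_iff₀ (mul_pos hθ (hpos u))]
    nlinarith [mul_pos hθ (hpos u)]
  · filter_upwards [hup (θ * ((a + 1) / 2)) (by nlinarith)] with u hu
    have h1 := ENNReal.toReal_mono (by finiteness) hu
    rw [ENNReal.toReal_mul, ← measureReal_def, ENNReal.toReal_ofReal (by nlinarith)] at h1
    rw [div_lt_iff₀ (mul_pos hθ (hpos u))]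
    nlinarith [mul_pos hθ (hpos u)]

end RuinModel

theorem theorem5p2 {d : ℕ} {Ω : Type*} [MeasurableSpace Ω] (P : Measure Ω)
    [IsProbabilityMeasure P]
    (X : ℕ → Ω → Fin d → ℝ) (Y : ℕ → Ω → ℝ)
    (hX_meas : ∀ i, Measurable (X i)) (hY_meas : ∀ i, Measurable (Y i))
    (hX_indep : iIndepFun X P) (hX_ident : ∀ i, IdentDistrib (X i) (X 0) P P)
    (hY_indep : iIndepFun Y P) (hY_ident : ∀ i, IdentDistrib (Y i) (Y 0) P P)
    (hXY_indep : IndepFun (fun ω i => X i ω) (fun ω i => Y i ω) P)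
    (p : Fin d → ℝ) (hp : ∀ j, 0 ≤ p j)
    (hX_int : Integrable (X 0) P)
    (hZ_int : Integrable (fun ω => X 0 ω - Y 0 ω • p) P)
    (hY_pos : ∀ᵐ ω ∂P, 0 < Y 0 ω)
    (b : Fin d → ℝ) (hb_pos : ∀ j, 0 < b j) (hb_sum : ∑ j, b j = 1)
    (L : Set (Fin d → ℝ)) (hL : RuinModel.IsRuinSet L)
    (c : Fin d → ℝ) (hc : c = -∫ ω, (X 0 ω - Y 0 ω • p) ∂P) (hc_pos : ∀ j, 0 < c j)
    (hFI : RuinModel.MemSubexpClass (RuinModel.surplusSet b L)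
      (RuinModel.integratedTail (P.map (X 0)) c)) :
    Tendsto (fun u : ℝ => RuinModel.ruinProb P X Y p b L u /
      RuinModel.tailIntegral (P.map (X 0)) c (RuinModel.surplusSet b L) u) atTop (𝓝 1) := by
  have hVi := RuinModel.iIndepFun_prodMk hX_meas hY_meas hX_indep hY_indep hXY_indep
  have hXYi : ∀ i, IndepFun (X i) (Y i) P := fun i =>
    hXY_indep.comp (measurable_pi_apply i) (measurable_pi_apply i)
  have hsub : Measurable fun q : (Fin d → ℝ) × ℝ => q.1 - q.2 • p := by fun_prop
  have hZm : ∀ i, Measurable fun ω => X i ω - Y i ω • p := fun i =>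
    (hX_meas i).sub ((hY_meas i).smul_const p)
  have hZ : iIndepFun (fun i ω => X i ω - Y i ω • p) P := hVi.comp (fun _ => _) fun _ => hsub
  have hZid : ∀ i, IdentDistrib (fun ω => X i ω - Y i ω • p) (fun ω => X 0 ω - Y 0 ω • p) P P :=
    fun i => (RuinModel.identDistrib_prodMk (hX_ident i) (hY_ident i) (hXYi i) (hXYi 0)).comp hsub
  have hpos : ∀ᵐ ω ∂P, ∀ i, 0 < Y i ω := ae_all_iff.2 fun i =>
    (hY_ident i).symm.ae_snd measurableSet_Ioi hY_pos
  have hZX : ∀ᵐ ω ∂P, ∀ i, X i ω - Y i ω • p ≤ X i ω := by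
    filter_upwards [hpos] with ω hω i
    exact sub_le_self _ (smul_nonneg (hω i).le hp)
  have hA := hL.isRiskRegion hb_pos
  have : IsProbabilityMeasure (P.map (X 0)) :=
    Measure.isProbabilityMeasure_map (hX_meas 0).aemeasurable
  obtain ⟨g, hg, hgA⟩ := hA.exists_functional
  obtain ⟨ν, θ, hν, hθ, hH⟩ :=
    RuinModel.exists_tail_law_of_memSubexpClass hg hA.isOpen hgA hFI
  have hup : ∀ b, θ < b → ∀ᶠ u in atTop,
      P {ω | ∃ n, u < g (RuinModel.walk (fun i => X i ω - Y i ω • p) n)} ≤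
        ENNReal.ofReal b * ν (Ioi u) := fun b hb =>
    RuinModel.eventually_measure_exceed_le hX_meas hX_ident hZm hZ hZid hZ_int hZX hc hc_pos hg hν
      hθ hH hb
  -- The upper bound feeds the lower one: it shows that the walk stays below a high level with
  -- probability near one.
  have hzero : Tendsto (fun u => P {ω | ∃ n, u < g (RuinModel.walk
      (fun i => X i ω - Y i ω • p) n)}) atTop (𝓝 0) := by
    have h1 := ENNReal.Tendsto.const_mul (a := ENNReal.ofReal (θ + 1)) hν.tendsto_tail
      (Or.inr ENNReal.ofReal_ne_top)
    rw [mul_zero] at h1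
    exact tendsto_of_tendsto_of_tendsto_of_le_of_le' tendsto_const_nhds h1
      (Eventually.of_forall fun _ => zero_le) (hup (θ + 1) (by linarith))
  have hlow : ∀ b, b < θ → ∀ᶠ u in atTop, ENNReal.ofReal b * ν (Ioi u) ≤
      P {ω | ∃ n, u < g (RuinModel.walk (fun i => X i ω - Y i ω • p) n)} := fun b hb =>
    RuinModel.eventually_le_measure_exceed hX_meas hY_meas hVi hXYi hX_ident hY_ident hp hZ hZid
      hZ_int hc hc_pos hg hν hθ hH hzero hb
  refine (RuinModel.tendsto_toReal_div_one hν hθ (fun u => measure_ne_top P _) hup hlow).congr' ?_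
  filter_upwards [eventually_gt_atTop 0] with u hu
  rw [RuinModel.tailIntegral_eq hg (fun j => (hc_pos j).le) (hgA u hu), hH u hu,
    ENNReal.toReal_mul, ENNReal.toReal_ofReal hθ.le]
  congr 1
  refine congrArg ENNReal.toReal (measure_congr ?_)
  filter_upwards [hpos, RuinModel.ae_tendsto_arrivalTime hY_meas hY_indep hY_ident hY_pos]
    with ω h1 h2
  refine propext ?_
  have := RuinModel.exists_riskReserve_mem_iff (X := X) (b := b) hp hL hu h1 h2
  simp only [hgA u hu] at this
  exact this.symm
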